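/- For $n\ge 0$ let $H_n$ be the (physicists') Hermite polynomial and $\hat H_n=2^{-n}H_n$ the monic one. Let $0\le\nu\le 1/4$, let $K$ be a positive integer, and let $\gamma_0,\dots,\gamma_K$ be real numbers with $\gamma_0=1$ and $\gamma_K\neq 0$. There is an integer $N$, depending only on $\nu$, $K$ and the $\gamma_j$, such that the following holds for every sequence $(\rho_n)_{n\ge 0}$ of positive real numbers with $$\frac{2\rho_{n-1}}{\rho_n}\le n^{\nu}\qquad (n\ge 1).$$ Put $q_n(x)=\sum_{j=0}^{K}\gamma_j\,\rho_{n-j}\,\hat H_{n-j}(x)$ for $n\ge K$. (a) For $n\ge N$ the polynomial $q_n$ has degree $n$ and only real and simple zeros; write them in increasing order as $\xi_1(n)<\dots<\xi_n(n)$. (b) If $n\ge N$ is even, then $q_n$ has exactly $n/2$ positive and $n/2$ negative zeros. If $n\ge N$ is odd, then $q_n$ has at least $(n-1)/2$ positive and at least $(n-1)/2$ negative zeros. (c) Suppose that $\rho_n=2^n$ for all $n$, so that $q_n=\sum_{j=0}^K\gamma_jH_{n-j}$. Let $\chi=(-1)^{i+1}\gamma_{2i+1}$, where $2i+1\le K$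 is the smallest odd index with $\gamma_{2i+1}\ne 0$, and $\chi=0$ if there is no such index. If $n\ge N$ is odd, then besides $(n-1)/2$ positive and $(n-1)/2$ negative zeros, $q_n$ has exactly one more zero, which is positive if $\chi>0$, negative if $\chi<0$, and equal to $0$ if $\chi=0$. (d) For every $k\in\mathbb Z$, $$\lim_{n\to\infty}2\sqrt n\,\xi_{k+n+1}(2n)=\frac{\pi}{2}+k\pi,\qquad \lim_{n\to\infty}2\sqrt n\,\xi_{k+n+1}(2n+1)=k\pi .$$ (e) For every bounded continuous function $f:\mathbb R\to\mathbb R$, $$\lim_{n\to\infty}\frac1n\sum_{j=1}^n f\!\left(\frac{\xi_j(n)}{\sqrt{2n}}\right)=\frac{2}{\pi}\int_{-1}^{1}f(x)\sqrt{1-x^2}\,dx .$$ -/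

import Mathlib

open Polynomial Filter Topology

namespace HermiteComb

/-- The monic Hermite polynomial `Ĥ_n`, i.e. `2⁻ⁿ H_n` with `H_n` the physicists' Hermite polynomial
(orthogonal for the weight `exp (-x²)`). Mathlib's `Polynomial.hermite n` is the monic
probabilists' polynomial `He_n`, and `Ĥ_n(x) = 2^(-n/2) He_n(√2 x)`. -/
noncomputable def monicHermite (n : ℕ) : ℝ[X] :=
  C ((√2 ^ n)⁻¹) * ((hermite n).map (Int.castRingHom ℝ)).comp (C √2 * X)

/-- `q_n = ∑_{j=0}^K γ_j ρ_{n-j} Ĥ_{n-j}`, meaningful for `n ≥ K`. -/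
noncomputable def q (K : ℕ) (γ ρ : ℕ → ℝ) (n : ℕ) : ℝ[X] :=
  ∑ j ∈ Finset.range (K + 1), C (γ j * ρ (n - j)) * monicHermite (n - j)

/-- `p` has degree `n`, all its zeros are real and simple, and they are
`x 1 < x 2 < ⋯ < x n` (the other values of `x` are irrelevant). -/
structure IsZeroEnum (p : ℝ[X]) (n : ℕ) (x : ℕ → ℝ) : Prop where
  natDegree_eq : p.natDegree = n
  strictMonoOn : StrictMonoOn x (Set.Icc 1 n)
  roots_eq : p.roots = (Finset.Icc 1 n).val.map x

/-- The number of positive zeros, with multiplicity. -/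
noncomputable def numPos (p : ℝ[X]) : ℕ := Multiset.card (p.roots.filter (fun x => 0 < x))

/-- The number of negative zeros, with multiplicity. -/
noncomputable def numNeg (p : ℝ[X]) : ℕ := Multiset.card (p.roots.filter (fun x => x < 0))

open Classical in
/-- `χ = (-1)^(i+1) γ_{2i+1}`, where `2i+1` is the smallest odd index (at most `K`) such that
`γ_{2i+1} ≠ 0`, and `χ = 0` if there is no such index. -/
noncomputable def chi (K : ℕ) (γ : ℕ → ℝ) : ℝ :=
  if h : ∃ i : ℕ, 2 * i + 1 ≤ K ∧ γ (2 * i + 1) ≠ 0 then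
    (-1) ^ (Nat.find h + 1) * γ (2 * Nat.find h + 1)
  else 0

end HermiteComb

namespace HermiteComb

/-! ### Physicists' Hermite polynomials -/

/-! For x² ≤ 2n the three-term recurrence bounds n^(j/2) |H_{n-j}(x)| by a constant times |H_n(x)| +
√n |H_{n-1}(x)| (`abs_eval_physHermite_sub_le`). The ratio condition lets the coefficient of H_{n-j}
in 2^n q_n / ρ_n grow at most like n^(j/4). Hence this polynomial differs from H_n by O(n^(-1/4))
times the same quantity, with a constant depending only on K and the γ_j
(`isHermitePerturbation_q`).

At a zero of H_{n-1} the second term drops out, so q_n has there the sign of H_n. These signs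
alternate, and q_n therefore has n simple real zeros interlacing with those of H_{n-1}
(`exists_isZeroEnum_q`). Everything else follows from interlacing and the perturbation bound.

Signs: the zeros of H_{n-1} are symmetric, which leaves only the middle zero for odd n undecided.
Its sign is that of q_n(0) up to a power of -1, and for ρ_n = 2^n the first nonzero odd-index
coefficient dominates q_n(0) (`eventually_sum_eval_zero_sign`).

Zeros near 0: by the Hermite differential equation H_n, and with it q_n, is close to a trigonometric
function of √(2n) x. Interlacing tells which zero of the limit is reached, moving by π/2 from degree
n - 1 to degree n (`IsHermiteLike.tendsto_zero`).

Semicircle law: Stieltjes' relation gives a recursion for the power sums of the zeros of H_n whose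
limit is the Catalan recursion (`tendsto_zeroMoment`). The zeros of q_n and of H_n lie in the same
gaps between zeros of H_{n-1}, so their averages agree in the limit (`abs_average_sub_le`). -/

/-- The physicists' Hermite polynomial `H_n`. -/
noncomputable def physHermite (n : ℕ) : ℝ[X] := C (2 ^ n) * monicHermite n

lemma physHermite_eq (n : ℕ) :
    physHermite n = C (√2 ^ n) * ((hermite n).map (Int.castRingHom ℝ)).comp (C √2 * X) := by
  have h : (2 : ℝ) ^ n * (√2 ^ n)⁻¹ = √2 ^ n := by
    have h2 : (2 : ℝ) ^ n = √2 ^ n * √2 ^ n := by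
      rw [← mul_pow, Real.mul_self_sqrt (by norm_num)]
    rw [h2, mul_assoc, mul_inv_cancel₀ (by positivity), mul_one]
  rw [physHermite, monicHermite, ← mul_assoc, ← C_mul, h]

lemma monicHermite_eq (n : ℕ) : monicHermite n = C ((2 ^ n)⁻¹) * physHermite n := by
  rw [physHermite, ← mul_assoc, ← C_mul, inv_mul_cancel₀ (by positivity), C_1, one_mul]

lemma physHermite_zero : physHermite 0 = 1 := by
  simp [physHermite_eq]

lemma physHermite_succ_eq_sub_derivative (n : ℕ) :
    physHermite (n + 1) = C 2 * X * physHermite n - derivative (physHermite n) := by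
  have h2 : (C 2 : ℝ[X]) = C √2 * C √2 := by
    rw [← C_mul, Real.mul_self_sqrt (by norm_num)]
  simp only [physHermite_eq, hermite_succ, derivative_comp, derivative_C_mul, Polynomial.map_sub,
    Polynomial.map_mul, map_X, sub_comp, mul_comp, X_comp, derivative_map, derivative_X, h2,
    pow_succ, C_mul]
  ring

/-- Together with `physHermite_succ_eq_sub_derivative`, this lowering relation yields both the
three-term recurrence and the Hermite differential equation. -/
lemma derivative_physHermite_succ (n : ℕ) :
    derivative (physHermite (n + 1)) = C (2 * (n + 1 : ℝ)) * physHermite n := by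
  induction n with
  | zero => simp [physHermite_succ_eq_sub_derivative, physHermite_zero]
  | succ n ih =>
    rw [physHermite_succ_eq_sub_derivative (n + 1), derivative_sub, ih, derivative_mul,
      derivative_C_mul, derivative_C_mul, ih, physHermite_succ_eq_sub_derivative n]
    simp only [derivative_X, C_mul, C_add, map_natCast, Nat.cast_add, Nat.cast_one, C_1]
    have : (C 2 : ℝ[X]) = 2 := rfl
    rw [this]
    ring

lemma derivative_physHermite (n : ℕ) :
    derivative (physHermite n) = C (2 * (n : ℝ)) * physHermite (n - 1) := by
  cases n with
  | zero => simp [physHermite_zero]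
  | succ n => simpa using derivative_physHermite_succ n

lemma physHermite_add_two (n : ℕ) :
    physHermite (n + 2) =
      C 2 * X * physHermite (n + 1) - C (2 * (n + 1 : ℝ)) * physHermite n := by
  rw [physHermite_succ_eq_sub_derivative (n + 1), derivative_physHermite_succ]

lemma eval_physHermite_add_two (n : ℕ) (x : ℝ) :
    (physHermite (n + 2)).eval x =
      2 * x * (physHermite (n + 1)).eval x - 2 * (n + 1) * (physHermite n).eval x := by
  simp [physHermite_add_two]

lemma eval_physHermite_one (x : ℝ) : (physHermite 1).eval x = 2 * x := by
  simp [physHermite_succ_eq_sub_derivative, physHermite_zero]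

lemma monicHermite_monic (n : ℕ) : (monicHermite n).natDegree = n ∧ (monicHermite n).Monic := by
  have h2 : (C √2 * X : ℝ[X]).natDegree = 1 := natDegree_C_mul_X _ (by positivity)
  have hm : ((hermite n).map (Int.castRingHom ℝ)).Monic := (hermite_monic n).map _
  have hd : ((hermite n).map (Int.castRingHom ℝ)).natDegree = n := by
    rw [(hermite_monic n).natDegree_map, natDegree_hermite]
  constructor
  · rw [monicHermite, natDegree_C_mul (by positivity), natDegree_comp, h2, hd, mul_one]
  · rw [Monic, monicHermite, leadingCoeff_mul, leadingCoeff_comp (by rw [h2]; norm_num), hd, hm,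
      leadingCoeff_C, leadingCoeff_C_mul_X, one_mul, inv_mul_cancel₀ (by positivity)]

lemma natDegree_physHermite (n : ℕ) : (physHermite n).natDegree = n := by
  rw [physHermite, natDegree_C_mul (by positivity), (monicHermite_monic n).1]

lemma leadingCoeff_physHermite (n : ℕ) : (physHermite n).leadingCoeff = 2 ^ n := by
  rw [physHermite, leadingCoeff_mul, leadingCoeff_C, (monicHermite_monic n).2, mul_one]

lemma eval_neg_physHermite (n : ℕ) (x : ℝ) :
    (physHermite n).eval (-x) = (-1) ^ n * (physHermite n).eval x := by
  induction n using Nat.twoStepInduction with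
  | zero => simp [physHermite_zero]
  | one => simp [eval_physHermite_one]
  | more n h1 h2 =>
    rw [eval_physHermite_add_two, eval_physHermite_add_two, h1, h2]
    ring

lemma eval_zero_physHermite_odd (l : ℕ) : (physHermite (2 * l + 1)).eval 0 = 0 := by
  have := eval_neg_physHermite (2 * l + 1) 0
  rw [neg_zero, Odd.neg_one_pow ⟨l, rfl⟩] at this
  linarith

lemma eval_zero_physHermite_even_pos (l : ℕ) : 0 < (-1) ^ l * (physHermite (2 * l)).eval 0 := by
  induction l with
  | zero => simp [physHermite_zero]
  | succ l ih =>
    rw [show 2 * (l + 1) = 2 * l + 2 by ring, eval_physHermite_add_two]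
    push_cast
    have : (0 : ℝ) < 2 * (2 * l + 1) := by positivity
    calc (0 : ℝ) < 2 * (2 * l + 1) * ((-1) ^ l * (physHermite (2 * l)).eval 0) :=
          mul_pos this ih
      _ = _ := by ring

/-- `H_n` is positive to the right of `√(2(n-1))`. -/
lemma eval_physHermite_pos {x : ℝ} (hx : 0 < x) (n : ℕ) (h : 2 * n ≤ x ^ 2) :
    0 < (physHermite n).eval x ∧
      x * (physHermite n).eval x ≤ (physHermite (n + 1)).eval x := by
  induction n with
  | zero => simp [physHermite_zero, eval_physHermite_one]; linarith
  | succ n ih =>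
    push_cast at h
    obtain ⟨h0, h1⟩ := ih (by linarith)
    have h2 : 0 < (physHermite (n + 1)).eval x := (mul_pos hx h0).trans_le h1
    refine ⟨h2, ?_⟩
    rw [eval_physHermite_add_two]
    -- The subtracted term 2(n+1) H_n is at most x² H_n ≤ x H_{n+1}, which leaves x H_{n+1} out of
    -- 2x H_{n+1}.
    nlinarith [mul_le_mul_of_nonneg_left h1 hx.le, mul_le_mul_of_nonneg_right h h0.le]

lemma sq_le_of_eval_physHermite_eq_zero {x : ℝ} {n : ℕ} (h : (physHermite n).eval x = 0) :
    x ^ 2 ≤ 2 * n := by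
  by_contra! hc
  rcases lt_trichotomy x 0 with hx | hx | hx
  · have := (eval_physHermite_pos (neg_pos.2 hx) n (by rw [neg_sq]; exact hc.le)).1
    rw [eval_neg_physHermite, h, mul_zero] at this
    exact this.false
  · rw [hx] at hc
    have : (0 : ℝ) ≤ n := Nat.cast_nonneg n
    linarith
  · exact ((eval_physHermite_pos hx n hc.le).1.trans_eq h).false

/-- In the oscillatory region, lower Hermite polynomials are controlled by `H_n` and `H_{n-1}`. -/
lemma abs_eval_physHermite_sub_le {n : ℕ} {x : ℝ} (hx : x ^ 2 ≤ 2 * n) (j : ℕ) (hj : 2 * j ≤ n) :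
    √n ^ j * |(physHermite (n - j)).eval x| ≤
      4 ^ j * (|(physHermite n).eval x| + √n * |(physHermite (n - 1)).eval x|) := by
  set S := |(physHermite n).eval x| + √n * |(physHermite (n - 1)).eval x| with hS
  have hS0 : 0 ≤ S := by positivity
  induction j using Nat.twoStepInduction with
  | zero => simp [hS]; positivity
  | one =>
    have : 0 ≤ |(physHermite n).eval x| := abs_nonneg _
    rw [pow_one, pow_one]
    linarith
  | more j h1 h2 =>
    have h1 := h1 (by omega)
    have h2 := h2 (by omega)
    obtain ⟨k, rfl⟩ : ∃ k, n = k + j + 2 := ⟨n - j - 2, by omega⟩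
    have e0 : k + j + 2 - j = k + 2 := by omega
    have e1 : k + j + 2 - (j + 1) = k + 1 := by omega
    have e2 : k + j + 2 - (j + 2) = k := by omega
    rw [e0] at h1
    rw [e1] at h2
    rw [e2]
    set n := k + j + 2 with hn
    set s := √(n : ℝ) with hs
    have hs2 : s ^ 2 = n := Real.sq_sqrt (Nat.cast_nonneg n)
    have hs0 : 0 ≤ s := Real.sqrt_nonneg _
    -- √2 ≤ 3/2, so 2|x| ≤ 3√n in the recurrence.
    have hxs : |x| ≤ 3 / 2 * s := abs_le_of_sq_le_sq (by nlinarith) (by positivity)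
    -- Since 2(j + 2) ≤ n, the factor 2(k + 1) of H_k in the recurrence is at least n.
    have hk : (n : ℝ) ≤ 2 * (k + 1) := by
      have : n ≤ 2 * (k + 1) := by omega
      exact_mod_cast this
    have key : (n : ℝ) * |(physHermite k).eval x| ≤
        3 * s * |(physHermite (k + 1)).eval x| + |(physHermite (k + 2)).eval x| := by
      calc (n : ℝ) * |(physHermite k).eval x|
          ≤ 2 * (k + 1) * |(physHermite k).eval x| := by gcongr
        _ = |2 * (k + 1) * (physHermite k).eval x| := by
          rw [abs_mul, abs_of_nonneg (by positivity : (0 : ℝ) ≤ 2 * (k + 1))]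
        _ = |2 * x * (physHermite (k + 1)).eval x - (physHermite (k + 2)).eval x| := by
          rw [eval_physHermite_add_two]; congr 1; ring
        _ ≤ |2 * x * (physHermite (k + 1)).eval x| + |(physHermite (k + 2)).eval x| := abs_sub _ _
        _ = 2 * |x| * |(physHermite (k + 1)).eval x| + |(physHermite (k + 2)).eval x| := by
          rw [abs_mul, abs_mul, abs_two]
        _ ≤ 2 * (3 / 2 * s) * |(physHermite (k + 1)).eval x|
            + |(physHermite (k + 2)).eval x| := by gcongr
        _ = _ := by ring
    calc s ^ (j + 2) * |(physHermite k).eval x|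
        = s ^ j * (n * |(physHermite k).eval x|) := by rw [pow_add, hs2]; ring
      _ ≤ s ^ j * (3 * s * |(physHermite (k + 1)).eval x| + |(physHermite (k + 2)).eval x|) := by
        gcongr
      _ = 3 * (s ^ (j + 1) * |(physHermite (k + 1)).eval x|)
          + s ^ j * |(physHermite (k + 2)).eval x| := by ring
      _ ≤ 3 * (4 ^ (j + 1) * S) + 4 ^ j * S := by gcongr
      -- The base 4 works because 3 · 4 + 1 ≤ 4².
      _ ≤ 4 ^ (j + 2) * S := by
        have : 0 ≤ 4 ^ j * S := by positivity
        rw [pow_add, pow_add]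
        linarith

/-! ### Enumerations of simple real zeros -/

namespace IsZeroEnum

variable {p : ℝ[X]} {n : ℕ} {x : ℕ → ℝ}

lemma exists_eq (h : IsZeroEnum p n x) (hp : p ≠ 0) {z : ℝ} (hz : p.eval z = 0) :
    ∃ i ∈ Finset.Icc 1 n, x i = z := by
  have : z ∈ p.roots := (mem_roots hp).2 hz
  rw [h.roots_eq] at this
  simpa using this

lemma eval_eq_zero (h : IsZeroEnum p n x) {i : ℕ} (hi : i ∈ Finset.Icc 1 n) :
    p.eval (x i) = 0 := by
  have : x i ∈ p.roots := by
    rw [h.roots_eq]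
    exact Multiset.mem_map_of_mem x hi
  exact (mem_roots'.1 this).2

lemma card_roots (h : IsZeroEnum p n x) : Multiset.card p.roots = n := by
  simp [h.roots_eq]

lemma eq_prod (h : IsZeroEnum p n x) :
    p = C p.leadingCoeff * ∏ j ∈ Finset.Icc 1 n, (X - C (x j)) := by
  conv_lhs => rw [← C_leadingCoeff_mul_prod_multiset_X_sub_C (p := p)
    (by rw [h.card_roots, h.natDegree_eq]), h.roots_eq, Multiset.map_map]
  rfl

/-- The sign of `p` between its `i`-th and its `(i+1)`-st zero. -/
lemma eval_sign (h : IsZeroEnum p n x) (hp : 0 < p.leadingCoeff) {i : ℕ} (hi : i ≤ n) {z : ℝ}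
    (h1 : ∀ j ∈ Finset.Icc 1 i, x j < z) (h2 : ∀ j ∈ Finset.Icc (i + 1) n, z < x j) :
    0 < (-1) ^ (n - i) * p.eval z := by
  have hd : Disjoint (Finset.Icc 1 i) (Finset.Icc (i + 1) n) := by
    rw [Finset.disjoint_left]
    intro a
    simp only [Finset.mem_Icc]
    omega
  have hu : Finset.Icc 1 n = Finset.Icc 1 i ∪ Finset.Icc (i + 1) n := by
    ext a
    simp only [Finset.mem_union, Finset.mem_Icc]
    omega
  have hs : (-1 : ℝ) ^ (n - i) * ∏ j ∈ Finset.Icc (i + 1) n, (z - x j) =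
      ∏ j ∈ Finset.Icc (i + 1) n, (x j - z) := by
    have : (-1 : ℝ) ^ (n - i) = ∏ j ∈ Finset.Icc (i + 1) n, (-1 : ℝ) := by
      rw [Finset.prod_const, Nat.card_Icc]
      congr 1
      omega
    rw [this, ← Finset.prod_mul_distrib]
    exact Finset.prod_congr rfl fun j _ => by ring
  rw [h.eq_prod, eval_mul, eval_C, eval_prod]
  simp only [eval_sub, eval_X, eval_C]
  rw [hu, Finset.prod_union hd]
  calc (0 : ℝ) < p.leadingCoeff * ((∏ j ∈ Finset.Icc 1 i, (z - x j)) *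
        ∏ j ∈ Finset.Icc (i + 1) n, (x j - z)) :=
      mul_pos hp (mul_pos (Finset.prod_pos fun j hj => sub_pos.2 (h1 j hj))
        (Finset.prod_pos fun j hj => sub_pos.2 (h2 j hj)))
    _ = _ := by rw [← hs]; ring

lemma lt (h : IsZeroEnum p n x) {i j : ℕ} (hi : 1 ≤ i) (hij : i < j) (hj : j ≤ n) : x i < x j :=
  h.strictMonoOn ⟨hi, by omega⟩ ⟨by omega, hj⟩ hij

lemma le (h : IsZeroEnum p n x) {i j : ℕ} (hi : 1 ≤ i) (hij : i ≤ j) (hj : j ≤ n) : x i ≤ x j :=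
  h.strictMonoOn.monotoneOn ⟨hi, by omega⟩ ⟨by omega, hj⟩ hij

lemma image_eq (h : IsZeroEnum p n x) : (Finset.Icc 1 n).image x = p.roots.toFinset := by
  rw [h.roots_eq]
  rfl

lemma card_filter_le (h : IsZeroEnum p n x) {i : ℕ} (hi : i ∈ Finset.Icc 1 n) :
    (p.roots.toFinset.filter (· ≤ x i)).card = i := by
  have : p.roots.toFinset.filter (· ≤ x i) = (Finset.Icc 1 i).image x := by
    rw [← h.image_eq]
    ext z
    simp only [Finset.mem_filter, Finset.mem_image, Finset.mem_Icc] at hi ⊢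
    constructor
    · rintro ⟨⟨j, hj, rfl⟩, hle⟩
      exact ⟨j, ⟨hj.1, (h.strictMonoOn.le_iff_le hj hi).1 hle⟩, rfl⟩
    · rintro ⟨j, hj, rfl⟩
      exact ⟨⟨j, ⟨hj.1, hj.2.trans hi.2⟩, rfl⟩, h.le hj.1 hj.2 hi.2⟩
  rw [this, Finset.card_image_of_injOn, Nat.card_Icc, Nat.add_sub_cancel]
  intro a ha b hb hab
  simp only [Finset.coe_Icc, Set.mem_Icc, Finset.mem_Icc] at ha hb hi
  exact h.strictMonoOn.injOn ⟨ha.1, ha.2.trans hi.2⟩ ⟨hb.1, hb.2.trans hi.2⟩ hab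

/-- The `i`-th zero is the one with exactly `i` roots at or below it, a description independent of
the enumeration. -/
lemma unique {x' : ℕ → ℝ} (h : IsZeroEnum p n x) (h' : IsZeroEnum p n x') {i : ℕ}
    (hi : i ∈ Finset.Icc 1 n) : x i = x' i := by
  have : x i ∈ (Finset.Icc 1 n).image x' := by
    rw [h'.image_eq, ← h.image_eq]
    exact Finset.mem_image_of_mem x hi
  obtain ⟨j, hj, hji⟩ := Finset.mem_image.1 this
  have h1 := h.card_filter_le hi
  have h2 := h'.card_filter_le hj
  rw [hji, h1] at h2
  subst h2
  exact hji.symm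

/-- If `p` is even or odd, its zeros are symmetric. -/
lemma symm_of_eval_neg (h : IsZeroEnum p n x) (hp : p ≠ 0) {c : ℝ}
    (hc : ∀ z, p.eval (-z) = c * p.eval z) {i : ℕ} (hi : i ∈ Finset.Icc 1 n) :
    x (n + 1 - i) = -x i := by
  have h' : IsZeroEnum p n (fun j => -x (n + 1 - j)) := by
    have hmono : StrictMonoOn (fun j => -x (n + 1 - j)) (Set.Icc 1 n) := by
      intro a ha b hb hab
      simp only [Set.mem_Icc] at ha hb
      exact neg_lt_neg (h.lt (by omega) (by omega) (by omega))
    refine ⟨h.natDegree_eq, hmono, ?_⟩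
    symm
    apply Multiset.eq_of_le_of_card_le
    · rw [Multiset.le_iff_subset]
      · intro z hz
        obtain ⟨j, hj, rfl⟩ := Multiset.mem_map.1 hz
        simp only [Finset.mem_val, Finset.mem_Icc] at hj
        rw [mem_roots hp, IsRoot.def, hc,
          h.eval_eq_zero (Finset.mem_Icc.2 ⟨by omega, by omega⟩), mul_zero]
      · refine Multiset.Nodup.map_on ?_ (Finset.nodup _)
        intro a ha b hb hab
        exact hmono.injOn (by simpa using ha) (by simpa using hb) hab
    · simp [h.card_roots]
  have := h.unique h' hi
  linarith

lemma numPos_eq (h : IsZeroEnum p n x) {a : ℕ} (ha : a ≤ n)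
    (h1 : ∀ j ∈ Finset.Icc 1 a, x j ≤ 0) (h2 : ∀ j ∈ Finset.Icc (a + 1) n, 0 < x j) :
    numPos p = n - a := by
  have : (Finset.Icc 1 n).filter (fun j => 0 < x j) = Finset.Icc (a + 1) n := by
    ext j
    simp only [Finset.mem_filter, Finset.mem_Icc] at h1 h2 ⊢
    constructor
    · rintro ⟨hj, hx⟩
      refine ⟨?_, hj.2⟩
      by_contra! hlt
      exact (h1 j ⟨hj.1, by omega⟩).not_gt hx
    · intro hj
      exact ⟨⟨by omega, hj.2⟩, h2 j hj⟩
  rw [numPos, h.roots_eq, Multiset.filter_map, Multiset.card_map]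
  change ((Finset.Icc 1 n).filter (fun j => 0 < x j)).card = _
  rw [this, Nat.card_Icc]
  omega

lemma numNeg_eq (h : IsZeroEnum p n x) {a : ℕ} (ha : a ≤ n)
    (h1 : ∀ j ∈ Finset.Icc 1 a, x j < 0) (h2 : ∀ j ∈ Finset.Icc (a + 1) n, 0 ≤ x j) :
    numNeg p = a := by
  have : (Finset.Icc 1 n).filter (fun j => x j < 0) = Finset.Icc 1 a := by
    ext j
    simp only [Finset.mem_filter, Finset.mem_Icc] at h1 h2 ⊢
    constructor
    · rintro ⟨hj, hx⟩
      refine ⟨hj.1, ?_⟩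
      by_contra! hlt
      exact (h2 j ⟨by omega, hj.2⟩).not_gt hx
    · intro hj
      exact ⟨⟨hj.1, by omega⟩, h1 j hj⟩
  rw [numNeg, h.roots_eq, Multiset.filter_map, Multiset.card_map]
  change ((Finset.Icc 1 n).filter (fun j => x j < 0)).card = _
  rw [this, Nat.card_Icc]
  omega

end IsZeroEnum

/-- `x 1 < y 1 < x 2 < y 2 < ⋯ < y n < x (n + 1)`. -/
def Interlaces (n : ℕ) (x y : ℕ → ℝ) : Prop :=
  ∀ i ∈ Finset.Icc 1 n, x i < y i ∧ y i < x (i + 1)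

/-- A polynomial of degree `n + 1` whose signs alternate at `n` points (with the last sign
negative) has only real and simple zeros, which interlace with these points. -/
lemma exists_isZeroEnum_of_alternating {p : ℝ[X]} {n : ℕ} {y : ℕ → ℝ}
    (hdeg : p.natDegree = n + 1) (hlead : 0 < p.leadingCoeff)
    (hy : StrictMonoOn y (Set.Icc 1 n))
    (hsign : ∀ i ∈ Finset.Icc 1 n, 0 < (-1) ^ (n + 1 - i) * p.eval (y i)) :
    ∃ x, IsZeroEnum p (n + 1) x ∧ Interlaces n x y := by
  have hp : p ≠ 0 := by rintro rfl; simp at hlead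
  have hdegpos : 0 < p.degree := natDegree_pos_iff_degree_pos.1 (by omega)
  have htop := p.tendsto_atTop_of_leadingCoeff_nonneg hdegpos hlead.le
  obtain ⟨b, hb1, hb2⟩ : ∃ b, (∀ i ∈ Finset.Icc 1 n, y i < b) ∧ 0 < p.eval b := by
    have h1 : ∀ᶠ b in atTop, ∀ i ∈ Finset.Icc 1 n, y i < b :=
      (Finset.eventually_all _).2 fun i _ => eventually_gt_atTop (y i)
    exact (h1.and (htop.eventually_gt_atTop 0)).exists
  obtain ⟨a, ha1, ha2⟩ : ∃ a, (∀ i ∈ Finset.Icc 1 n, a < y i) ∧ a < b ∧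
      0 < (-1) ^ (n + 1) * p.eval a := by
    -- The sign of `p` near -∞ is read off from (-1)^(n+1) p(-X), whose leading coefficient is that
    -- of `p`.
    set r := C ((-1 : ℝ) ^ (n + 1)) * p.comp (C (-1) * X) with hr
    have hl : (C (-1) * X : ℝ[X]).natDegree = 1 := natDegree_C_mul_X _ (by norm_num)
    have hrd : r.natDegree = n + 1 := by
      rw [hr, natDegree_C_mul (by positivity), natDegree_comp, hl, hdeg, mul_one]
    have hrl : r.leadingCoeff = p.leadingCoeff := by
      rw [hr, leadingCoeff_mul, leadingCoeff_comp (by rw [hl]; norm_num), leadingCoeff_C,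
        leadingCoeff_C_mul_X, hdeg, mul_comm, mul_assoc, ← mul_pow]
      norm_num
    have htop' := r.tendsto_atTop_of_leadingCoeff_nonneg
      (natDegree_pos_iff_degree_pos.1 (by omega)) (hrl ▸ hlead.le)
    have h1 : ∀ᶠ a : ℝ in atTop, ∀ i ∈ Finset.Icc 1 n, -y i < a :=
      (Finset.eventually_all _).2 fun i _ => eventually_gt_atTop (-y i)
    obtain ⟨a, h1, h2, h3⟩ :=
      (h1.and ((eventually_gt_atTop (-b)).and (htop'.eventually_gt_atTop 0))).exists
    refine ⟨-a, fun i hi => by linarith [h1 i hi], by linarith, ?_⟩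
    simpa [hr] using h3
  -- The points `y` completed by `a` and `b`: n + 2 points with alternating signs, hence a zero in
  -- each of the n + 1 gaps.
  set w : ℕ → ℝ := fun i => if i = 0 then a else if i = n + 1 then b else y i with hw
  have hw0 : w 0 = a := by simp [hw]
  have hwb : w (n + 1) = b := by simp [hw]
  have hwy : ∀ i ∈ Finset.Icc 1 n, w i = y i := by
    intro i hi
    rw [Finset.mem_Icc] at hi
    simp only [hw]
    rw [if_neg (by omega), if_neg (by omega)]
  have hwlt : ∀ i ≤ n, w i < w (i + 1) := by
    intro i hi
    rcases Nat.eq_zero_or_pos i with rfl | hi0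
    · rcases Nat.eq_zero_or_pos n with rfl | hn
      · rw [hw0, hwb]; exact ha2.1
      · have h1 : (1 : ℕ) ∈ Finset.Icc 1 n := Finset.mem_Icc.2 ⟨le_rfl, hn⟩
        rw [hw0, zero_add, hwy 1 h1]
        exact ha1 1 h1
    · have h1 : i ∈ Finset.Icc 1 n := Finset.mem_Icc.2 ⟨hi0, hi⟩
      rcases hi.eq_or_lt with rfl | hin
      · rw [hwb, hwy _ h1]; exact hb1 _ h1
      · have h2 : i + 1 ∈ Finset.Icc 1 n := Finset.mem_Icc.2 ⟨by omega, hin⟩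
        rw [hwy _ h1, hwy _ h2]
        exact hy ⟨hi0, hi⟩ ⟨by omega, hin⟩ (by omega)
  have hws : ∀ i ≤ n + 1, 0 < (-1) ^ (n + 1 - i) * p.eval (w i) := by
    intro i hi
    rcases Nat.eq_zero_or_pos i with rfl | hi0
    · simpa [hw0] using ha2.2
    · rcases hi.eq_or_lt with rfl | hin
      · simpa [hwb] using hb2
      · have h1 : i ∈ Finset.Icc 1 n := Finset.mem_Icc.2 ⟨hi0, by omega⟩
        rw [hwy _ h1]
        exact hsign i h1
  have hroot : ∀ i, ∃ z, i ≤ n → w i < z ∧ z < w (i + 1) ∧ p.eval z = 0 := by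
    intro i
    by_cases hi : i ≤ n
    · have h1 := hws i (by omega)
      have h2 := hws (i + 1) (by omega)
      rw [show n + 1 - i = (n + 1 - (i + 1)) + 1 by omega, pow_succ] at h1
      have hcont : ContinuousOn (fun z => (-1) ^ (n + 1 - (i + 1)) * p.eval z)
          (Set.Icc (w i) (w (i + 1))) := by fun_prop
      obtain ⟨z, hz, hz0⟩ := intermediate_value_Ioo (hwlt i hi).le hcont
        (show (0 : ℝ) ∈ Set.Ioo _ _ from ⟨by linarith, h2⟩)
      refine ⟨z, fun _ => ⟨hz.1, hz.2, ?_⟩⟩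
      exact (mul_eq_zero.1 hz0).resolve_left (by positivity)
    · exact ⟨0, fun h => absurd h hi⟩
  choose z hz using hroot
  have hmono : StrictMonoOn (fun i => z (i - 1)) (Set.Icc 1 (n + 1)) := by
    have hwmono : ∀ i j, i ≤ j → j ≤ n + 1 → w i ≤ w j := by
      intro i j hij
      induction j, hij using Nat.le_induction with
      | base => intro _; exact le_rfl
      | succ j hij ih => intro hj; exact (ih (by omega)).trans (hwlt j (by omega)).le
    intro i hi j hj hij
    simp only [Set.mem_Icc] at hi hj
    have h1 := (hz (i - 1) (by omega)).2.1
    have h2 := (hz (j - 1) (by omega)).1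
    exact h1.trans_le ((hwmono _ _ (by omega) (by omega)).trans h2.le)
  refine ⟨fun i => z (i - 1), ⟨hdeg, hmono, ?_⟩, ?_⟩
  -- The n + 1 distinct zeros found exhaust the degree, so they are simple and there is no other.
  · symm
    apply Multiset.eq_of_le_of_card_le
    · rw [Multiset.le_iff_subset]
      · intro t ht
        obtain ⟨j, hj, rfl⟩ := Multiset.mem_map.1 ht
        simp only [Finset.mem_val, Finset.mem_Icc] at hj
        rw [mem_roots hp, IsRoot.def]
        exact (hz _ (by omega)).2.2
      · refine Multiset.Nodup.map_on ?_ (Finset.nodup _)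
        intro i hi j hj hij
        exact hmono.injOn (by simpa using hi) (by simpa using hj) hij
    · refine (p.card_roots').trans ?_
      simp [hdeg]
  · intro i hi
    have hi' := Finset.mem_Icc.1 hi
    have h1 := (hz (i - 1) (by omega)).2.1
    have h2 := (hz i (by omega)).1
    rw [show i - 1 + 1 = i by omega, hwy i hi] at h1
    rw [hwy i hi] at h2
    exact ⟨h1, by simpa using h2⟩

/-! ### The zeros of the Hermite polynomials -/

/-- `a` enumerates the zeros of `H_n`, and `H_{n+1}` alternates in sign there. -/
def HermiteEnum (n : ℕ) (a : ℕ → ℝ) : Prop :=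
  IsZeroEnum (physHermite n) n a ∧
    ∀ i ∈ Finset.Icc 1 n, 0 < (-1) ^ (n + 1 - i) * (physHermite (n + 1)).eval (a i)

lemma physHermite_leadingCoeff_pos (n : ℕ) : 0 < (physHermite n).leadingCoeff := by
  rw [leadingCoeff_physHermite]; positivity

/-- At a zero of H_{n+1} the recurrence reads H_{n+2} = -2(n+1) H_n, and interlacing fixes the sign
of H_n there by the number of its zeros to the left. -/
lemma HermiteEnum.exists_succ {n : ℕ} {a : ℕ → ℝ} (h : HermiteEnum n a) :
    ∃ b, HermiteEnum (n + 1) b ∧ Interlaces n b a := by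
  obtain ⟨b, hb, hba⟩ := exists_isZeroEnum_of_alternating (natDegree_physHermite (n + 1))
    (physHermite_leadingCoeff_pos _) h.1.strictMonoOn h.2
  refine ⟨b, ⟨hb, fun i hi => ?_⟩, hba⟩
  have hi' := Finset.mem_Icc.1 hi
  have hs := h.1.eval_sign (physHermite_leadingCoeff_pos n) (i := i - 1) (z := b i) (by omega)
    (fun j hj => ?_) (fun j hj => ?_)
  · rw [eval_physHermite_add_two, hb.eval_eq_zero hi]
    have e1 : n - (i - 1) = n + 1 - i := by omega
    have e2 : n + 1 + 1 - i = n + 1 - i + 1 := by omega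
    rw [e1] at hs
    rw [e2, pow_succ]
    have : (0 : ℝ) < 2 * (n + 1) := by positivity
    nlinarith [mul_pos this hs]
  · rw [Finset.mem_Icc] at hj
    have h1 := (hba j (Finset.mem_Icc.2 ⟨hj.1, by omega⟩)).2
    exact h1.trans_le (hb.le (by omega) (by omega) hi'.2)
  · rw [Finset.mem_Icc] at hj
    have h1 := (hba j (Finset.mem_Icc.2 ⟨by omega, hj.2⟩)).1
    exact (hb.le hi'.1 (by omega) (by omega)).trans_lt h1

lemma hermiteEnum_zero : HermiteEnum 0 (fun _ => 0) := by
  refine ⟨⟨natDegree_physHermite 0, ?_, ?_⟩, ?_⟩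
  · intro a ha b hb
    simp only [Set.mem_Icc] at ha
    omega
  · simp [physHermite_zero]
  · simp

/-- Auxiliary recursive construction of the zeros of the Hermite polynomials. -/
noncomputable def hermiteZeroAux : (n : ℕ) → {a : ℕ → ℝ // HermiteEnum n a}
  | 0 => ⟨fun _ => 0, hermiteEnum_zero⟩
  | n + 1 => ⟨(hermiteZeroAux n).2.exists_succ.choose,
      (hermiteZeroAux n).2.exists_succ.choose_spec.1⟩

/-- The `i`-th zero of `H_n` in increasing order, for `1 ≤ i ≤ n`. -/
noncomputable def hermiteZero (n i : ℕ) : ℝ := (hermiteZeroAux n).1 i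

lemma isZeroEnum_hermiteZero (n : ℕ) : IsZeroEnum (physHermite n) n (hermiteZero n) :=
  (hermiteZeroAux n).2.1

lemma hermiteZero_sign (n : ℕ) : ∀ i ∈ Finset.Icc 1 n,
    0 < (-1) ^ (n + 1 - i) * (physHermite (n + 1)).eval (hermiteZero n i) :=
  (hermiteZeroAux n).2.2

/-- Holds by construction: each enumeration is chosen by `HermiteEnum.exists_succ` from the previous
one. -/
lemma interlaces_hermiteZero (n : ℕ) : Interlaces n (hermiteZero (n + 1)) (hermiteZero n) :=
  (hermiteZeroAux n).2.exists_succ.choose_spec.2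

lemma physHermite_ne_zero (n : ℕ) : physHermite n ≠ 0 :=
  leadingCoeff_ne_zero.1 (physHermite_leadingCoeff_pos n).ne'

lemma hermiteZero_symm {n i : ℕ} (hi : i ∈ Finset.Icc 1 n) :
    hermiteZero n (n + 1 - i) = -hermiteZero n i :=
  (isZeroEnum_hermiteZero n).symm_of_eval_neg (physHermite_ne_zero n) (eval_neg_physHermite n) hi

lemma hermiteZero_middle (m : ℕ) : hermiteZero (2 * m + 1) (m + 1) = 0 := by
  have := hermiteZero_symm (n := 2 * m + 1) (i := m + 1) (Finset.mem_Icc.2 ⟨by omega, by omega⟩)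
  rw [show 2 * m + 1 + 1 - (m + 1) = m + 1 by omega] at this
  linarith

lemma hermiteZero_even_signs {m : ℕ} (hm : 1 ≤ m) :
    hermiteZero (2 * m) m < 0 ∧ 0 < hermiteZero (2 * m) (m + 1) := by
  have h1 := hermiteZero_symm (n := 2 * m) (i := m) (Finset.mem_Icc.2 ⟨by omega, by omega⟩)
  rw [show 2 * m + 1 - m = m + 1 by omega] at h1
  have h2 := (isZeroEnum_hermiteZero (2 * m)).lt (i := m) (j := m + 1) hm (by omega) (by omega)
  constructor <;> linarith

lemma sq_hermiteZero_le {n i : ℕ} (hi : i ∈ Finset.Icc 1 n) : hermiteZero n i ^ 2 ≤ 2 * n :=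
  sq_le_of_eval_physHermite_eq_zero ((isZeroEnum_hermiteZero n).eval_eq_zero hi)

/-! ### Behaviour of the Hermite polynomials near the origin -/

lemma eval_derivative_derivative_physHermite (n : ℕ) (z : ℝ) :
    (derivative (derivative (physHermite n))).eval z =
      2 * z * (derivative (physHermite n)).eval z - 2 * n * (physHermite n).eval z := by
  cases n with
  | zero => simp [physHermite_zero]
  | succ n =>
    rw [derivative_physHermite_succ, derivative_C_mul, physHermite_succ_eq_sub_derivative]
    simp only [eval_mul, eval_C, eval_sub, eval_X, Nat.cast_add, Nat.cast_one]
    ring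

/-- The amplitude of `H_n` at the origin. -/
noncomputable def amplitude (n : ℕ) : ℝ :=
  |(physHermite n).eval 0| + |(derivative (physHermite n)).eval 0 / √(2 * n)|

lemma amplitude_nonneg (n : ℕ) : 0 ≤ amplitude n := by unfold amplitude; positivity

/-- With u = H_n and v = u'/√(2n), the differential equation gives (e^(-2z²)(u² + v²))' = -4z u²
e^(-2z²), so the damped energy is largest at the origin. -/
lemma energy_le {n : ℕ} (hn : 1 ≤ n) (z : ℝ) :
    (physHermite n).eval z ^ 2 + ((derivative (physHermite n)).eval z / √(2 * n)) ^ 2 ≤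
      Real.exp (2 * z ^ 2) * amplitude n ^ 2 := by
  set w := √(2 * (n : ℝ)) with hw
  have hn' : (0 : ℝ) < 2 * n := by positivity
  have hw2 : w ^ 2 = 2 * n := Real.sq_sqrt hn'.le
  have hw0 : 0 < w := Real.sqrt_pos.2 hn'
  set φ : ℝ → ℝ := fun z => ((physHermite n).eval z ^ 2 +
    ((derivative (physHermite n)).eval z / w) ^ 2) * Real.exp (-(2 * z ^ 2)) with hφ
  have hd : ∀ z, HasDerivAt φ
      (-(4 * z * (physHermite n).eval z ^ 2 * Real.exp (-(2 * z ^ 2)))) z := by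
    intro z
    have h1 := (physHermite n).hasDerivAt z
    have h2 := (derivative (physHermite n)).hasDerivAt z
    have h3 : HasDerivAt (fun z : ℝ => Real.exp (-(2 * z ^ 2)))
        (Real.exp (-(2 * z ^ 2)) * (-(4 * z))) z := by
      have : HasDerivAt (fun z : ℝ => -(2 * z ^ 2)) (-(4 * z)) z :=
        (((hasDerivAt_pow 2 z).const_mul 2).neg).congr_deriv (by norm_num; ring)
      exact this.exp
    refine HasDerivAt.congr_deriv (f := φ)
      (((h1.fun_pow 2).fun_add ((h2.div_const w).fun_pow 2)).fun_mul h3) ?_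
    rw [eval_derivative_derivative_physHermite, ← hw2]
    simp only [Nat.cast_ofNat, Nat.add_one_sub_one, pow_one]
    field_simp
    ring
  have hcont : Continuous φ := continuous_iff_continuousAt.2 fun z => (hd z).continuousAt
  have h0 : φ z ≤ φ 0 := by
    rcases le_total 0 z with hz | hz
    · refine antitoneOn_of_deriv_nonpos (convex_Ici 0) hcont.continuousOn
        (fun z _ => (hd z).differentiableAt.differentiableWithinAt) (fun z hz => ?_)
        (Set.mem_Ici.2 le_rfl) (Set.mem_Ici.2 hz) hz
      rw [interior_Ici, Set.mem_Ioi] at hz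
      rw [(hd z).deriv, neg_nonpos]
      positivity
    · refine monotoneOn_of_deriv_nonneg (convex_Iic 0) hcont.continuousOn
        (fun z _ => (hd z).differentiableAt.differentiableWithinAt) (fun z hz => ?_)
        (Set.mem_Iic.2 hz) (Set.mem_Iic.2 le_rfl) hz
      rw [interior_Iic, Set.mem_Iio] at hz
      rw [(hd z).deriv]
      have : 0 ≤ (physHermite n).eval z ^ 2 * Real.exp (-(2 * z ^ 2)) := by positivity
      nlinarith
  have h1 : φ 0 ≤ amplitude n ^ 2 := by
    simp only [hφ, amplitude, ← hw]
    set a := eval 0 (physHermite n)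
    set b := eval 0 (derivative (physHermite n)) / w
    have : 0 ≤ |a| * |b| := by positivity
    norm_num
    nlinarith [sq_abs a, sq_abs b]
  have h2 := h0.trans h1
  simp only [hφ, Real.exp_neg] at h2
  rwa [← div_eq_mul_inv, div_le_iff₀ (Real.exp_pos _), mul_comm (amplitude n ^ 2)] at h2

lemma abs_eval_le_amplitude {n : ℕ} (hn : 1 ≤ n) {z : ℝ} (hz : |z| ≤ 1) :
    |(physHermite n).eval z| ≤ 3 * amplitude n ∧
      |(derivative (physHermite n)).eval z / √(2 * n)| ≤ 3 * amplitude n := by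
  have h := energy_le hn z
  have hz2 : z ^ 2 ≤ 1 := (sq_le_one_iff_abs_le_one z).2 hz
  have he : Real.exp (2 * z ^ 2) ≤ 9 := by
    calc Real.exp (2 * z ^ 2) ≤ Real.exp (1 + 1) := Real.exp_le_exp.2 (by linarith)
      _ = Real.exp 1 * Real.exp 1 := Real.exp_add _ _
      _ ≤ 3 * 3 := by
        have := Real.exp_one_lt_d9
        have h0 := Real.exp_pos 1
        gcongr <;> linarith
      _ = 9 := by norm_num
  have ha := amplitude_nonneg n
  have h9 : Real.exp (2 * z ^ 2) * amplitude n ^ 2 ≤ (3 * amplitude n) ^ 2 := by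
    rw [mul_pow]
    gcongr
    linarith
  constructor
  · have h0 := sq_nonneg ((derivative (physHermite n)).eval z / √(2 * (n : ℝ)))
    exact abs_le_of_sq_le_sq (by linarith) (by positivity)
  · exact abs_le_of_sq_le_sq (by linarith [sq_nonneg ((physHermite n).eval z)]) (by positivity)

lemma abs_sub_le_of_deriv_bound {f f' : ℝ → ℝ} {C z : ℝ} (hf : ∀ t, HasDerivAt f (f' t) t)
    (hb : ∀ t, |t| ≤ |z| → |f' t| ≤ C) : |f z - f 0| ≤ C * |z| := by
  have := (convex_Icc (-|z|) |z|).norm_image_sub_le_of_norm_hasDerivWithin_le (f := f) (f' := f')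
    (C := C) (x := 0) (y := z) (fun t _ => (hf t).hasDerivWithinAt)
    (fun t ht => by simpa using hb t (abs_le.2 ht)) (by simp) ⟨neg_abs_le z, le_abs_self z⟩
  simpa using this

/-- Near the origin, `H_n` is a trigonometric function of frequency `√(2n)`. -/
lemma abs_eval_physHermite_sub_trig_le {n : ℕ} (hn : 1 ≤ n) {z : ℝ} (hz : |z| ≤ 1) :
    |(physHermite n).eval z - ((physHermite n).eval 0 * Real.cos (√(2 * n) * z) +
      (derivative (physHermite n)).eval 0 / √(2 * n) * Real.sin (√(2 * n) * z))| ≤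
      12 * z ^ 2 * amplitude n := by
  set w := √(2 * (n : ℝ)) with hw
  have hn' : (0 : ℝ) < 2 * n := by positivity
  have hw2 : w ^ 2 = 2 * n := Real.sq_sqrt hn'.le
  have hw0 : 0 < w := Real.sqrt_pos.2 hn'
  set u : ℝ → ℝ := fun z => (physHermite n).eval z with hu
  set v : ℝ → ℝ := fun z => (derivative (physHermite n)).eval z / w with hv
  have du : ∀ t, HasDerivAt u (w * v t) t := by
    intro t
    refine ((physHermite n).hasDerivAt t).congr_deriv ?_
    simp only [hv]
    field_simp
  have dv : ∀ t, HasDerivAt v (2 * t * v t - w * u t) t := by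
    intro t
    refine (((derivative (physHermite n)).hasDerivAt t).div_const w).congr_deriv ?_
    rw [eval_derivative_derivative_physHermite, ← hw2]
    simp only [hv, hu]
    field_simp
  have dl : ∀ t, HasDerivAt (fun t => w * t) w t := by
    intro t
    simpa using (hasDerivAt_id t).const_mul w
  have dc := fun t => (dl t).cos
  have ds := fun t => (dl t).sin
  have hb : ∀ t, |t| ≤ |z| → |2 * t * v t| ≤ 6 * |z| * amplitude n := by
    intro t ht
    have := (abs_eval_le_amplitude hn (ht.trans hz)).2
    calc |2 * t * v t| = 2 * |t| * |v t| := by rw [abs_mul, abs_mul, abs_two]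
      _ ≤ 2 * |z| * (3 * amplitude n) := by gcongr
      _ = _ := by ring
  -- Rotating (u, v) by the angle w t cancels the oscillation u' = w v, v' = -w u. Only the drift 2
  -- t v remains to be integrated.
  have hA := abs_sub_le_of_deriv_bound (z := z) (C := 6 * |z| * amplitude n)
    (f := fun t => u t * Real.cos (w * t) - v t * Real.sin (w * t))
    (f' := fun t => -(2 * t * v t) * Real.sin (w * t))
    (fun t => (((du t).fun_mul (dc t)).fun_sub ((dv t).fun_mul (ds t))).congr_deriv (by ring))
    (fun t ht => by
      rw [abs_mul, abs_neg]
      exact (mul_le_of_le_one_right (abs_nonneg _) (Real.abs_sin_le_one _)).trans (hb t ht))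
  have hB := abs_sub_le_of_deriv_bound (z := z) (C := 6 * |z| * amplitude n)
    (f := fun t => u t * Real.sin (w * t) + v t * Real.cos (w * t))
    (f' := fun t => (2 * t * v t) * Real.cos (w * t))
    (fun t => (((du t).fun_mul (ds t)).fun_add ((dv t).fun_mul (dc t))).congr_deriv (by ring))
    (fun t ht => by
      rw [abs_mul]
      exact (mul_le_of_le_one_right (abs_nonneg _) (Real.abs_cos_le_one _)).trans (hb t ht))
  simp only [mul_zero, Real.cos_zero, Real.sin_zero, mul_one, sub_zero, zero_add] at hA hB
  have hsc := Real.sin_sq_add_cos_sq (w * z)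
  set s := Real.sin (w * z) with hs
  set c := Real.cos (w * z) with hc
  have key : u z - (u 0 * c + v 0 * s) =
      (u z * c - v z * s - u 0) * c + (u z * s + v z * c - v 0) * s := by
    linear_combination (-u z) * hsc
  have hbound : 6 * |z| * amplitude n * |z| = 6 * z ^ 2 * amplitude n := by
    rw [← sq_abs z]; ring
  rw [hbound] at hA hB
  change |u z - (u 0 * c + v 0 * s)| ≤ _
  rw [key]
  calc _ ≤ |(u z * c - v z * s - u 0) * c| + |(u z * s + v z * c - v 0) * s| := abs_add_le _ _
    _ ≤ 6 * z ^ 2 * amplitude n + 6 * z ^ 2 * amplitude n := by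
      rw [abs_mul, abs_mul]
      exact add_le_add
        ((mul_le_of_le_one_right (abs_nonneg _) (Real.abs_cos_le_one _)).trans hA)
        ((mul_le_of_le_one_right (abs_nonneg _) (Real.abs_sin_le_one _)).trans hB)
    _ = _ := by ring

/-- `f` is a relative perturbation of `H_n` of size `ε` in the oscillatory region. -/
def IsHermitePerturbation (n : ℕ) (f : ℝ → ℝ) (ε : ℝ) : Prop :=
  ∀ z : ℝ, z ^ 2 ≤ 2 * n → |f z - (physHermite n).eval z| ≤
    ε * (|(physHermite n).eval z| + √n * |(physHermite (n - 1)).eval z|)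

lemma IsHermitePerturbation.abs_sub_trig_le {n : ℕ} (hn : 1 ≤ n) {f : ℝ → ℝ} {ε : ℝ} (hε : 0 ≤ ε)
    (hf : IsHermitePerturbation n f ε) {z : ℝ} (hz : |z| ≤ 1) :
    |f z - ((physHermite n).eval 0 * Real.cos (√(2 * n) * z) +
      (derivative (physHermite n)).eval 0 / √(2 * n) * Real.sin (√(2 * n) * z))| ≤
      (12 * z ^ 2 + 6 * ε) * amplitude n := by
  have h1 := abs_eval_physHermite_sub_trig_le hn hz
  have hn1 : (1 : ℝ) ≤ n := by exact_mod_cast hn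
  have h2 := hf z (by nlinarith [(sq_le_one_iff_abs_le_one z).2 hz])
  obtain ⟨h3, h4⟩ := abs_eval_le_amplitude hn hz
  -- As H_n' = 2n H_{n-1}, the quantity √n H_{n-1} is the normalised derivative divided by √2.
  have h5 : √n * |(physHermite (n - 1)).eval z| ≤ 3 * amplitude n := by
    refine le_trans ?_ h4
    have hsn : 0 < √(n : ℝ) := Real.sqrt_pos.2 (by linarith)
    have hs2 : 0 < √(2 : ℝ) := by positivity
    have hle : √(2 : ℝ) ≤ 2 := Real.sqrt_le_iff.2 ⟨by norm_num, by norm_num⟩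
    rw [derivative_physHermite, eval_mul, eval_C, Real.sqrt_mul (by norm_num), abs_div, abs_mul,
      abs_of_nonneg (by positivity : (0 : ℝ) ≤ 2 * n),
      abs_of_nonneg (by positivity : 0 ≤ √2 * √(n : ℝ)), le_div_iff₀ (by positivity)]
    have : √(n : ℝ) * √n = n := Real.mul_self_sqrt (by linarith)
    calc √n * |(physHermite (n - 1)).eval z| * (√2 * √n)
        = √2 * (√n * √n) * |(physHermite (n - 1)).eval z| := by ring
      _ ≤ 2 * n * |(physHermite (n - 1)).eval z| := by rw [this]; gcongr
  calc _ ≤ |f z - (physHermite n).eval z| + |(physHermite n).eval z -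
        ((physHermite n).eval 0 * Real.cos (√(2 * n) * z) +
        (derivative (physHermite n)).eval 0 / √(2 * n) * Real.sin (√(2 * n) * z))| :=
        abs_sub_le _ _ _
    _ ≤ ε * (3 * amplitude n + 3 * amplitude n) + 12 * z ^ 2 * amplitude n := by
      refine add_le_add (h2.trans ?_) h1
      gcongr
    _ = _ := by ring

/-! ### Limits of scaled zeros near the origin -/

lemma sin_le_sin_of_mem {δ θ : ℝ} (h0 : 0 ≤ δ) (h1 : δ ≤ θ) (h2 : θ ≤ Real.pi - δ) :
    Real.sin δ ≤ Real.sin θ := by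
  rcases le_total θ (Real.pi / 2) with h | h
  · exact Real.sin_le_sin_of_le_of_le_pi_div_two (by linarith [Real.pi_pos]) h h1
  · rw [← Real.sin_pi_sub θ]
    exact Real.sin_le_sin_of_le_of_le_pi_div_two (by linarith [Real.pi_pos]) (by linarith)
      (by linarith)

/-- If continuous functions converge locally uniformly to a sine vanishing at `M`, then their
first zeros beyond points tending to `M - π/2` tend to `M`. -/
lemma tendsto_first_zero {F : ℕ → ℝ → ℝ} {c M : ℝ} (hc : c ≠ 0)
    (hF : ∀ n, Continuous (F n))
    (hU : ∀ R, TendstoUniformlyOn F (fun x => c * Real.sin (x - M)) atTop (Set.Icc (-R) R))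
    {l t : ℕ → ℝ} (hl : Tendsto l atTop (𝓝 (M - Real.pi / 2)))
    (ht : ∀ᶠ n in atTop, l n < t n ∧ F n (t n) = 0 ∧ ∀ z, F n z = 0 → l n < z → t n ≤ z) :
    Tendsto t atTop (𝓝 M) := by
  have hpi := Real.pi_pos
  rw [Metric.tendsto_atTop']
  suffices h : ∀ δ, 0 < δ → δ ≤ Real.pi / 4 → ∀ᶠ n in atTop, |t n - M| ≤ δ by
    intro ε hε
    have h1 := h (min (ε / 2) (Real.pi / 4)) (by positivity) (min_le_right _ _)
    obtain ⟨N, hN⟩ := eventually_atTop.1 h1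
    refine ⟨N, fun n hn => ?_⟩
    rw [Real.dist_eq]
    exact (hN n hn.le).trans_lt ((min_le_left _ _).trans_lt (by linarith))
  intro δ hδ hδ4
  have hs : 0 < Real.sin δ := Real.sin_pos_of_pos_of_lt_pi hδ (by linarith)
  have hη : 0 < |c| * Real.sin δ := by positivity
  have hu := Metric.tendstoUniformlyOn_iff.1 (hU (|M| + Real.pi)) _ hη
  have hl1 : ∀ᶠ n in atTop, M - 3 * Real.pi / 4 < l n := hl.eventually_const_lt (by linarith)
  have hl2 : ∀ᶠ n in atTop, l n < M - δ := hl.eventually_lt_const (by linarith)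
  filter_upwards [hu, hl1, hl2, ht] with n hu hl1 hl2 ⟨ht1, ht2, ht3⟩
  have hMabs := abs_le.1 (le_refl |M|)
  have hu' : ∀ x, M - Real.pi ≤ x → x ≤ M + Real.pi →
      |c * Real.sin (x - M) - F n x| < |c| * Real.sin δ := by
    intro x hx1 hx2
    have := hu x ⟨by linarith, by linarith⟩
    rwa [Real.dist_eq] at this
  -- From `l n` to M - δ the sine is at least sin δ in absolute value, so `F n` has no zero there.
  have hlow : M - δ < t n := by
    by_contra! hle
    have h1 := hu' (t n) (by linarith) (by linarith)
    rw [ht2, sub_zero, abs_mul] at h1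
    have h2 := lt_of_mul_lt_mul_left h1 (abs_nonneg c)
    have h3 : Real.sin δ ≤ Real.sin (M - t n) :=
      sin_le_sin_of_mem hδ.le (by linarith) (by linarith)
    rw [← abs_neg, ← Real.sin_neg, neg_sub] at h2
    exact (h3.trans (le_abs_self _)).not_gt h2
  -- `c * F n` changes sign across [M - δ, M + δ]; the zero obtained lies beyond `l n` and so bounds
  -- `t n`.
  have hup : t n ≤ M + δ := by
    have h1 := hu' (M - δ) (by linarith) (by linarith)
    have h2 := hu' (M + δ) (by linarith) (by linarith)
    rw [sub_sub_cancel_left, Real.sin_neg] at h1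
    rw [add_sub_cancel_left] at h2
    have hcont : ContinuousOn (fun z => c * F n z) (Set.Icc (M - δ) (M + δ)) :=
      (continuous_const.mul (hF n)).continuousOn
    have e1 : c * F n (M - δ) < 0 := by
      have : |c * (c * -Real.sin δ - F n (M - δ))| < c * c * Real.sin δ := by
        rw [abs_mul, ← abs_mul_abs_self c, mul_assoc]
        exact mul_lt_mul_of_pos_left h1 (abs_pos.2 hc)
      have := (abs_lt.1 this).1
      nlinarith
    have e2 : 0 < c * F n (M + δ) := by
      have : |c * (c * Real.sin δ - F n (M + δ))| < c * c * Real.sin δ := by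
        rw [abs_mul, ← abs_mul_abs_self c, mul_assoc]
        exact mul_lt_mul_of_pos_left h2 (abs_pos.2 hc)
      have := (abs_lt.1 this).2
      nlinarith
    obtain ⟨z, hz, hz0⟩ := intermediate_value_Ioo (by linarith) hcont
      (show (0 : ℝ) ∈ Set.Ioo _ _ from ⟨e1, e2⟩)
    have hz1 : F n z = 0 := (mul_eq_zero.1 hz0).resolve_left hc
    exact (ht3 z hz1 (hl2.trans hz.1)).trans hz.2.le
  rw [abs_le]
  constructor <;> linarith

/-- A family of polynomials which are small perturbations of the Hermite polynomials and whose
zeros `x n i` interlace with those of `H_{n-1}`. -/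
structure IsHermiteLike (p : ℕ → ℝ[X]) (x : ℕ → ℕ → ℝ) : Prop where
  ne_zero : ∀ᶠ n in atTop, p n ≠ 0
  isZeroEnum : ∀ᶠ n in atTop, IsZeroEnum (p n) n (x n)
  interlaces : ∀ᶠ n in atTop, Interlaces (n - 1) (x n) (hermiteZero (n - 1))
  perturbation : ∃ ε : ℕ → ℝ, Tendsto ε atTop (𝓝 0) ∧ (∀ n, 0 ≤ ε n) ∧
    ∀ᶠ n in atTop, IsHermitePerturbation n (fun z => (p n).eval z) (ε n)

lemma isHermiteLike_physHermite : IsHermiteLike physHermite hermiteZero where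
  ne_zero := Eventually.of_forall physHermite_ne_zero
  isZeroEnum := Eventually.of_forall isZeroEnum_hermiteZero
  interlaces := by
    filter_upwards [eventually_ge_atTop 1] with n hn
    obtain ⟨m, rfl⟩ : ∃ m, n = m + 1 := ⟨n - 1, by omega⟩
    exact interlaces_hermiteZero m
  perturbation :=
    ⟨fun _ => 0, tendsto_const_nhds, fun _ => le_rfl, Eventually.of_forall fun n z _ => by simp⟩

namespace IsHermiteLike

variable {p : ℕ → ℝ[X]} {x : ℕ → ℕ → ℝ}

/-- Rescaled by √(2n) and divided by the signed amplitude `a m`, the error is at most 12 R²/(2n) +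
6ε for |y| ≤ R. -/
lemma tendstoUniformlyOn (hp : IsHermiteLike p x) {n : ℕ → ℕ} (hn : Tendsto n atTop atTop)
    {a : ℕ → ℝ} {G : ℝ → ℝ} (ha : ∀ m, a m ≠ 0) (hamp : ∀ m, amplitude (n m) = |a m|)
    (hG : ∀ m y, (physHermite (n m)).eval 0 * Real.cos y +
      (derivative (physHermite (n m))).eval 0 / √(2 * (n m : ℝ)) * Real.sin y = a m * G y)
    (R : ℝ) :
    TendstoUniformlyOn (fun m y => (p (n m)).eval (y / √(2 * (n m : ℝ))) / a m) G atTop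
      (Set.Icc (-R) R) := by
  obtain ⟨ε, hε, hε0, hpert⟩ := hp.perturbation
  rw [Metric.tendstoUniformlyOn_iff]
  intro δ hδ
  have hlim : Tendsto (fun k : ℕ => 12 * (R ^ 2 / (2 * (k : ℝ))) + 6 * ε k) atTop (𝓝 0) := by
    have h1 : Tendsto (fun k : ℕ => R ^ 2 / (2 * (k : ℝ))) atTop (𝓝 0) :=
      Tendsto.const_div_atTop
        (tendsto_natCast_atTop_atTop.const_mul_atTop (by norm_num : (0 : ℝ) < 2)) _
    simpa using (h1.const_mul 12).add (hε.const_mul 6)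
  have hR : ∀ᶠ k : ℕ in atTop, R ^ 2 ≤ 2 * (k : ℝ) :=
    (tendsto_natCast_atTop_atTop.const_mul_atTop (by norm_num : (0 : ℝ) < 2)).eventually_ge_atTop _
  filter_upwards [hn.eventually hpert, hn.eventually (eventually_ge_atTop 1), hn.eventually hR,
    (hlim.comp hn).eventually_lt_const hδ] with m h1 h2 h3 h4 y hy
  have h2' : (0 : ℝ) < 2 * (n m : ℝ) := by positivity
  have hw : 0 < √(2 * (n m : ℝ)) := Real.sqrt_pos.2 h2'
  have hy2 : y ^ 2 ≤ R ^ 2 := sq_le_sq' hy.1 hy.2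
  have hz2 : (y / √(2 * (n m : ℝ))) ^ 2 ≤ R ^ 2 / (2 * (n m : ℝ)) := by
    rw [div_pow, Real.sq_sqrt h2'.le]
    gcongr
  have hz1 : |y / √(2 * (n m : ℝ))| ≤ 1 := by
    rw [← sq_le_one_iff_abs_le_one]
    exact hz2.trans (div_le_one_of_le₀ h3 h2'.le)
  have key := h1.abs_sub_trig_le h2 (hε0 _) hz1
  rw [mul_div_cancel₀ _ hw.ne', hG, hamp] at key
  have ham : 0 < |a m| := abs_pos.2 (ha m)
  rw [dist_comm, Real.dist_eq, ← mul_div_cancel_left₀ (G y) (ha m), ← sub_div, abs_div,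
    div_lt_iff₀ ham]
  refine key.trans_lt (mul_lt_mul_of_pos_right (lt_of_le_of_lt ?_ h4) ham)
  simp only [Function.comp_apply]
  gcongr

/-- By interlacing, zero number `idx m` is the first one beyond zero number `idx m - 1` of H_{n-1}.
The limit of the latter selects which zero of the limiting sine is reached. -/
lemma tendsto_zero (hp : IsHermiteLike p x) {n idx : ℕ → ℕ} (hn : Tendsto n atTop atTop)
    (hidx : ∀ᶠ m in atTop, 2 ≤ idx m ∧ idx m ≤ n m)
    {a : ℕ → ℝ} {c M : ℝ} (hc : c ≠ 0) (ha : ∀ m, a m ≠ 0) (hamp : ∀ m, amplitude (n m) = |a m|)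
    (hG : ∀ m y, (physHermite (n m)).eval 0 * Real.cos y +
      (derivative (physHermite (n m))).eval 0 / √(2 * (n m : ℝ)) * Real.sin y =
        a m * (c * Real.sin (y - M)))
    (hl : Tendsto (fun m => √(2 * (n m : ℝ)) * hermiteZero (n m - 1) (idx m - 1)) atTop
      (𝓝 (M - Real.pi / 2))) :
    Tendsto (fun m => √(2 * (n m : ℝ)) * x (n m) (idx m)) atTop (𝓝 M) := by
  refine tendsto_first_zero hc (fun m => ?_) (hp.tendstoUniformlyOn hn ha hamp hG) hl ?_
  · fun_prop
  filter_upwards [hn.eventually hp.isZeroEnum, hn.eventually hp.interlaces,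
    hn.eventually hp.ne_zero, hidx] with m h1 h2 h3 h4
  have h2' : (0 : ℝ) < 2 * (n m : ℝ) := by
    have : 0 < n m := by omega
    positivity
  have hw : 0 < √(2 * (n m : ℝ)) := Real.sqrt_pos.2 h2'
  have hi := h2 (idx m - 1) (Finset.mem_Icc.2 ⟨by omega, by omega⟩)
  rw [show idx m - 1 + 1 = idx m by omega] at hi
  refine ⟨mul_lt_mul_of_pos_left hi.2 hw, ?_, fun z hz hlz => ?_⟩
  · rw [mul_div_cancel_left₀ _ hw.ne', h1.eval_eq_zero (Finset.mem_Icc.2 ⟨by omega, h4.2⟩),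
      zero_div]
  · have hz0 := (div_eq_zero_iff.1 hz).resolve_right (ha m)
    obtain ⟨j, hj, hjz⟩ := h1.exists_eq h3 hz0
    rw [Finset.mem_Icc] at hj
    rw [eq_div_iff hw.ne', mul_comm] at hjz
    rw [← hjz] at hlz ⊢
    have hlz' := lt_of_mul_lt_mul_left hlz hw.le
    refine mul_le_mul_of_nonneg_left (h1.le (by omega) ?_ hj.2) hw.le
    by_contra! hlt
    have := h1.le hj.1 (show j ≤ idx m - 1 by omega) (by omega)
    linarith [hi.1]

end IsHermiteLike

lemma derivative_eval_zero_even (m : ℕ) :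
    (derivative (physHermite (2 * m))).eval 0 = 0 := by
  cases m with
  | zero => simp [physHermite_zero]
  | succ m =>
    rw [derivative_physHermite, eval_mul, show 2 * (m + 1) - 1 = 2 * m + 1 by omega,
      eval_zero_physHermite_odd, mul_zero]

lemma eval_zero_physHermite_even_ne (m : ℕ) : (physHermite (2 * m)).eval 0 ≠ 0 := by
  intro h
  have := eval_zero_physHermite_even_pos m
  rw [h, mul_zero] at this
  exact this.false

lemma derivative_eval_zero_odd_ne (m : ℕ) :
    (derivative (physHermite (2 * m + 1))).eval 0 / √(2 * ((2 * m + 1 : ℕ) : ℝ)) ≠ 0 := by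
  rw [derivative_physHermite_succ, eval_mul, eval_C]
  exact div_ne_zero (mul_ne_zero (by positivity) (eval_zero_physHermite_even_ne m))
    (Real.sqrt_pos.2 (by positivity)).ne'

lemma tendsto_sqrt_ratio (a b : ℝ) :
    Tendsto (fun m : ℕ => √(4 * m + a) / √(4 * m + b)) atTop (𝓝 1) := by
  have h1 : Tendsto (fun m : ℕ => (4 * (m : ℝ) + a) / (4 * m + b)) atTop (𝓝 1) := by
    have hb : Tendsto (fun m : ℕ => 4 * (m : ℝ) + b) atTop atTop :=
      tendsto_atTop_add_const_right _ _
        (tendsto_natCast_atTop_atTop.const_mul_atTop (by norm_num : (0 : ℝ) < 4))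
    have h2 : Tendsto (fun m : ℕ => 1 + (a - b) / (4 * (m : ℝ) + b)) atTop (𝓝 (1 + 0)) :=
      tendsto_const_nhds.add (Tendsto.const_div_atTop hb _)
    rw [add_zero] at h2
    refine h2.congr' ?_
    filter_upwards [hb.eventually_gt_atTop 0] with m hm
    field_simp
    ring
  have h3 := h1.sqrt
  rw [Real.sqrt_one] at h3
  refine h3.congr' ?_
  have hb : Tendsto (fun m : ℕ => 4 * (m : ℝ) + b) atTop atTop :=
    tendsto_atTop_add_const_right _ _
      (tendsto_natCast_atTop_atTop.const_mul_atTop (by norm_num : (0 : ℝ) < 4))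
  filter_upwards [hb.eventually_gt_atTop 0] with m hm
  rw [Real.sqrt_div' _ hm.le]

/-- Zeros of H_{n-1} come scaled by √(2(n-1)), while `IsHermiteLike.tendsto_zero` needs them scaled
by √(2n). -/
lemma tendsto_rescale {y : ℕ → ℝ} {L : ℝ} (a b : ℝ)
    (h : Tendsto (fun m : ℕ => √(4 * m + b) * y m) atTop (𝓝 L)) :
    Tendsto (fun m : ℕ => √(4 * m + a) * y m) atTop (𝓝 L) := by
  have h1 := (tendsto_sqrt_ratio a b).mul h
  rw [one_mul] at h1
  refine h1.congr' ?_
  have hb : Tendsto (fun m : ℕ => 4 * (m : ℝ) + b) atTop atTop :=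
    tendsto_atTop_add_const_right _ _
      (tendsto_natCast_atTop_atTop.const_mul_atTop (by norm_num : (0 : ℝ) < 4))
  filter_upwards [hb.eventually_gt_atTop 0] with m hm
  have : 0 < √(4 * (m : ℝ) + b) := Real.sqrt_pos.2 hm
  field_simp

lemma scale_even (m : ℕ) : √(2 * ((2 * m : ℕ) : ℝ)) = √(4 * m + 0) := by
  congr 1
  push_cast
  ring

lemma scale_odd (m : ℕ) : √(2 * ((2 * m + 1 : ℕ) : ℝ)) = √(4 * m + 2) := by
  congr 1
  push_cast
  ring

/-- The indices are eventually positive, so the truncation in `toNat` does not affect the limits. -/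
lemma eventually_toNat_add (k : ℤ) :
    ∀ᶠ m : ℕ in atTop, 2 ≤ (k + m + 1).toNat ∧ (k + m + 1).toNat ≤ 2 * m ∧
      (k + m + 1).toNat - 1 = (k - 1 + m + 1).toNat := by
  filter_upwards [eventually_ge_atTop (k.natAbs + 2)] with m hm
  omega

lemma IsHermiteLike.tendsto_even {p : ℕ → ℝ[X]} {x : ℕ → ℕ → ℝ} (hp : IsHermiteLike p x) {k : ℤ}
    (h : Tendsto (fun m : ℕ => √(4 * m + 2) * hermiteZero (2 * m + 1) (k + m + 1).toNat) atTop
      (𝓝 (k * Real.pi))) :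
    Tendsto (fun m : ℕ => √(4 * m + 0) * x (2 * m) (k + m + 1).toNat) atTop
      (𝓝 (Real.pi / 2 + k * Real.pi)) := by
  have hn : Tendsto (fun m : ℕ => 2 * m) atTop atTop :=
    tendsto_atTop_mono (fun m => show m ≤ _ by omega) tendsto_id
  have := hp.tendsto_zero (n := fun m => 2 * m) (idx := fun m => (k + m + 1).toNat)
    (c := -(-1) ^ k) (M := Real.pi / 2 + k * Real.pi) hn
    ((eventually_toNat_add k).mono fun m hm => ⟨hm.1, hm.2.1⟩)
    (neg_ne_zero.2 (zpow_ne_zero _ (by norm_num))) eval_zero_physHermite_even_ne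
    (fun m => by simp [amplitude, derivative_eval_zero_even]) (fun m y => ?_) ?_
  · simpa only [scale_even] using this
  · rw [derivative_eval_zero_even, zero_div, zero_mul, add_zero,
      show y - (Real.pi / 2 + k * Real.pi) = y - k * Real.pi - Real.pi / 2 by ring,
      Real.sin_sub_pi_div_two, Real.cos_sub_int_mul_pi]
    have : ((-1 : ℝ) ^ k) * (-1) ^ k = 1 := by
      rw [← mul_zpow]; norm_num
    linear_combination (-(eval 0 (physHermite (2 * m)) * Real.cos y)) * this
  · simp only [scale_even]
    -- Shifting `m` by one turns the preceding degree 2m - 1 into 2m + 1, as in `h`.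
    rw [add_sub_cancel_left, ← tendsto_add_atTop_iff_nat 1]
    have h1 := tendsto_rescale 4 2 h
    refine h1.congr' ?_
    filter_upwards [eventually_ge_atTop (k.natAbs + 2)] with m hm
    congr 2
    · push_cast; ring
    · omega

lemma IsHermiteLike.tendsto_odd {p : ℕ → ℝ[X]} {x : ℕ → ℕ → ℝ} (hp : IsHermiteLike p x) {k : ℤ}
    (h : Tendsto (fun m : ℕ => √(4 * m + 0) * hermiteZero (2 * m) (k - 1 + m + 1).toNat) atTop
      (𝓝 (Real.pi / 2 + (k - 1 : ℤ) * Real.pi))) :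
    Tendsto (fun m : ℕ => √(4 * m + 2) * x (2 * m + 1) (k + m + 1).toNat) atTop
      (𝓝 (k * Real.pi)) := by
  have hn : Tendsto (fun m : ℕ => 2 * m + 1) atTop atTop :=
    tendsto_atTop_mono (fun m => show m ≤ _ by omega) tendsto_id
  have := hp.tendsto_zero (n := fun m => 2 * m + 1) (idx := fun m => (k + m + 1).toNat)
    (c := (-1) ^ k) (M := k * Real.pi) hn
    ((eventually_toNat_add k).mono fun m hm => ⟨hm.1, by omega⟩)
    (zpow_ne_zero _ (by norm_num)) derivative_eval_zero_odd_ne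
    (fun m => by simp [amplitude, eval_zero_physHermite_odd]) (fun m y => ?_) ?_
  · simpa only [scale_odd] using this
  · rw [eval_zero_physHermite_odd, zero_mul, zero_add, Real.sin_sub_int_mul_pi]
    have : ((-1 : ℝ) ^ k) * (-1) ^ k = 1 := by
      rw [← mul_zpow]; norm_num
    linear_combination (-((derivative (physHermite (2 * m + 1))).eval 0 /
      √(2 * ((2 * m + 1 : ℕ) : ℝ)) * Real.sin y)) * this
  · simp only [scale_odd]
    have h1 := tendsto_rescale 2 0 h
    have e : k * Real.pi - Real.pi / 2 = Real.pi / 2 + (k - 1 : ℤ) * Real.pi := by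
      push_cast; ring
    rw [e]
    refine h1.congr' ?_
    filter_upwards [eventually_toNat_add k] with m hm
    rw [hm.2.2, Nat.add_sub_cancel]

/-- Anchored at the middle zero of H_{2m+1}, which is 0; each step advances by π/2 twice, from odd
to even degree and back to odd. -/
lemma tendsto_hermiteZero_nat (k : ℕ) :
    Tendsto (fun m : ℕ => √(4 * m + 2) * hermiteZero (2 * m + 1) ((k : ℤ) + m + 1).toNat) atTop
      (𝓝 ((k : ℤ) * Real.pi)) := by
  induction k with
  | zero =>
    simp only [Nat.cast_zero, Int.cast_zero, zero_mul]
    refine tendsto_const_nhds.congr fun m => ?_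
    rw [show ((0 : ℤ) + m + 1).toNat = m + 1 by omega, hermiteZero_middle, mul_zero]
  | succ k ih =>
    have h := isHermiteLike_physHermite.tendsto_even ih
    have e : ((k + 1 : ℕ) : ℤ) - 1 = k := by push_cast; ring
    rw [← e] at h
    exact isHermiteLike_physHermite.tendsto_odd h

lemma tendsto_hermiteZero_odd (k : ℤ) :
    Tendsto (fun m : ℕ => √(4 * m + 2) * hermiteZero (2 * m + 1) (k + m + 1).toNat) atTop
      (𝓝 (k * Real.pi)) := by
  rcases le_total 0 k with hk | hk
  · lift k to ℕ using hk
    exact tendsto_hermiteZero_nat k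
  · obtain ⟨j, rfl⟩ : ∃ j : ℕ, k = -(j : ℤ) := ⟨k.natAbs, by omega⟩
    have h := (tendsto_hermiteZero_nat j).neg
    have e : ((-(j : ℤ) : ℤ) : ℝ) * Real.pi = -((j : ℤ) * Real.pi) := by push_cast; ring
    rw [e]
    refine h.congr' ?_
    filter_upwards [eventually_ge_atTop (j + 2)] with m hm
    rw [← mul_neg, ← hermiteZero_symm (Finset.mem_Icc.2 ⟨by omega, by omega⟩)]
    congr 2
    omega

lemma tendsto_hermiteZero_even (k : ℤ) :
    Tendsto (fun m : ℕ => √(4 * m + 0) * hermiteZero (2 * m) (k + m + 1).toNat) atTop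
      (𝓝 (Real.pi / 2 + k * Real.pi)) :=
  isHermiteLike_physHermite.tendsto_even (tendsto_hermiteZero_odd k)

lemma IsHermiteLike.tendsto_zero_even {p : ℕ → ℝ[X]} {x : ℕ → ℕ → ℝ} (hp : IsHermiteLike p x)
    (k : ℤ) : Tendsto (fun n : ℕ => 2 * √(n : ℝ) * x (2 * n) (k + n + 1).toNat) atTop
      (𝓝 (Real.pi / 2 + k * Real.pi)) := by
  refine (hp.tendsto_even (tendsto_hermiteZero_odd k)).congr fun m => ?_
  rw [add_zero, Real.sqrt_mul (by norm_num), show (4 : ℝ) = 2 ^ 2 by norm_num,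
    Real.sqrt_sq (by norm_num)]

lemma IsHermiteLike.tendsto_zero_odd {p : ℕ → ℝ[X]} {x : ℕ → ℕ → ℝ} (hp : IsHermiteLike p x)
    (k : ℤ) : Tendsto (fun n : ℕ => 2 * √(n : ℝ) * x (2 * n + 1) (k + n + 1).toNat) atTop
      (𝓝 (k * Real.pi)) := by
  refine (tendsto_rescale 0 2 (hp.tendsto_odd (tendsto_hermiteZero_even (k - 1)))).congr
    fun m => ?_
  rw [add_zero, Real.sqrt_mul (by norm_num), show (4 : ℝ) = 2 ^ 2 by norm_num,
    Real.sqrt_sq (by norm_num)]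

/-! ### Linear combinations of Hermite polynomials -/

/-- A combination of `H_{n-1}, …, H_{n-K}` is small compared to `H_n` and `√n H_{n-1}`, as long
as the coefficients grow slower than `√n ^ j`. -/
lemma abs_sum_physHermite_le {n K : ℕ} (hn : 1 ≤ n) (hK : 2 * K ≤ n) {c γ : ℕ → ℝ}
    (hc : ∀ j ∈ Finset.Icc 1 K, |c j| ≤ |γ j| * √√n ^ j) {z : ℝ} (hz : z ^ 2 ≤ 2 * n) :
    |∑ j ∈ Finset.Icc 1 K, c j * (physHermite (n - j)).eval z| ≤
      (∑ j ∈ Finset.Icc 1 K, |γ j| * 4 ^ j) / √√n *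
        (|(physHermite n).eval z| + √n * |(physHermite (n - 1)).eval z|) := by
  set S := |(physHermite n).eval z| + √n * |(physHermite (n - 1)).eval z| with hS
  set r := √√(n : ℝ) with hr
  have hr1 : 1 ≤ r := by
    rw [hr, Real.one_le_sqrt, Real.one_le_sqrt]
    exact_mod_cast hn
  have hr0 : 0 < r := by linarith
  have hr2 : r ^ 2 = √n := Real.sq_sqrt (Real.sqrt_nonneg _)
  have hS0 : 0 ≤ S := by positivity
  rw [Finset.sum_div, Finset.sum_mul]
  refine (Finset.abs_sum_le_sum_abs _ _).trans (Finset.sum_le_sum fun j hj => ?_)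
  have hj' := Finset.mem_Icc.1 hj
  have h1 := abs_eval_physHermite_sub_le hz j (by omega)
  rw [← hS, ← hr2, sq, mul_pow] at h1
  rw [abs_mul, div_mul_eq_mul_div, le_div_iff₀ hr0]
  calc |c j| * |(physHermite (n - j)).eval z| * r
      ≤ |γ j| * r ^ j * |(physHermite (n - j)).eval z| * r ^ j := by
        gcongr
        · exact hc j hj
        · exact le_self_pow₀ hr1 (by omega)
    _ = |γ j| * (r ^ j * r ^ j * |(physHermite (n - j)).eval z|) := by ring
    _ ≤ |γ j| * (4 ^ j * S) := by gcongr
    _ = _ := by ring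

/-- The quotient telescopes into `j` factors, each at most n^ν ≤ n^(1/4) = √√n. Against the factor
√n ^ j of `abs_eval_physHermite_sub_le` this gains at least one √√n when j ≥ 1. -/
lemma two_pow_mul_ratio_le {ν : ℝ} (hν0 : 0 ≤ ν) (hν1 : ν ≤ 1 / 4) {ρ : ℕ → ℝ}
    (hρ : ∀ n, 0 < ρ n) (h : ∀ n : ℕ, 1 ≤ n → 2 * ρ (n - 1) / ρ n ≤ (n : ℝ) ^ ν)
    {n : ℕ} (j : ℕ) (hj : j ≤ n) : 2 ^ j * ρ (n - j) / ρ n ≤ √√n ^ j := by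
  induction j with
  | zero => simp [(hρ n).ne']
  | succ j ih =>
    have ih := ih (by omega)
    have hn1 : (1 : ℝ) ≤ n := by exact_mod_cast (by omega : 1 ≤ n)
    have h1 := h (n - j) (by omega)
    rw [Nat.sub_sub] at h1
    have h2 : (((n - j : ℕ) : ℝ)) ^ ν ≤ √√n := by
      calc (((n - j : ℕ) : ℝ)) ^ ν ≤ (n : ℝ) ^ ν := by
            refine Real.rpow_le_rpow (Nat.cast_nonneg _) ?_ hν0
            exact_mod_cast Nat.sub_le n j
        _ ≤ (n : ℝ) ^ (1 / 4 : ℝ) := Real.rpow_le_rpow_of_exponent_le hn1 hν1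
        _ = √√n := by
          rw [Real.sqrt_eq_rpow, Real.sqrt_eq_rpow, ← Real.rpow_mul (by linarith)]
          norm_num
    have hpos := hρ (n - j)
    have hposn := hρ n
    have hpos1 := hρ (n - (j + 1))
    calc 2 ^ (j + 1) * ρ (n - (j + 1)) / ρ n
        = (2 * ρ (n - (j + 1)) / ρ (n - j)) * (2 ^ j * ρ (n - j) / ρ n) := by
          field_simp; ring
      _ ≤ √√n * √√n ^ j := by
          have := h1.trans h2
          gcongr
      _ = _ := by ring

lemma eval_q (K : ℕ) (γ ρ : ℕ → ℝ) (n : ℕ) (z : ℝ) :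
    (q K γ ρ n).eval z = ∑ j ∈ Finset.range (K + 1),
      γ j * ρ (n - j) / 2 ^ (n - j) * (physHermite (n - j)).eval z := by
  rw [q, eval_finsetSum]
  refine Finset.sum_congr rfl fun j _ => ?_
  rw [monicHermite_eq, eval_mul, eval_mul, eval_C, eval_C]
  ring

lemma sum_range_succ_eq_add_sum_Icc (f : ℕ → ℝ) (K : ℕ) :
    ∑ j ∈ Finset.range (K + 1), f j = f 0 + ∑ j ∈ Finset.Icc 1 K, f j := by
  rw [Finset.range_eq_Ico, Finset.sum_eq_sum_Ico_succ_bot (Nat.succ_pos K)]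
  rfl

/-- The factor 2^n / ρ_n turns the leading term into H_n itself. The resulting error bound does not
involve ρ. -/
lemma isHermitePerturbation_q {ν : ℝ} (hν0 : 0 ≤ ν) (hν1 : ν ≤ 1 / 4) {K : ℕ} {γ ρ : ℕ → ℝ}
    (hγ : γ 0 = 1) (hρ : ∀ n, 0 < ρ n)
    (h : ∀ n : ℕ, 1 ≤ n → 2 * ρ (n - 1) / ρ n ≤ (n : ℝ) ^ ν) {n : ℕ} (hn : 1 ≤ n)
    (hK : 2 * K ≤ n) :
    IsHermitePerturbation n (fun z => (C (2 ^ n / ρ n) * q K γ ρ n).eval z)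
      ((∑ j ∈ Finset.Icc 1 K, |γ j| * 4 ^ j) / √√n) := by
  intro z hz
  have hρn := hρ n
  have key := abs_sum_physHermite_le hn hK (c := fun j => γ j * (2 ^ j * ρ (n - j) / ρ n))
    (γ := γ) (fun j hj => ?_) hz
  · convert key using 2
    simp only
    rw [eval_mul, eval_C, eval_q, sum_range_succ_eq_add_sum_Icc, mul_add, Finset.mul_sum, hγ,
      Nat.sub_zero, one_mul]
    have : 2 ^ n / ρ n * (ρ n / 2 ^ n * (physHermite n).eval z) = (physHermite n).eval z := by
      field_simp
    rw [this, add_sub_cancel_left]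
    refine Finset.sum_congr rfl fun j hj => ?_
    rw [Finset.mem_Icc] at hj
    have h2 : (2 : ℝ) ^ n = 2 ^ j * 2 ^ (n - j) := by
      rw [← pow_add]; congr 1; omega
    rw [h2]
    field_simp
  · rw [Finset.mem_Icc] at hj
    have := hρ (n - j)
    rw [abs_mul, abs_of_pos (by positivity : 0 < 2 ^ j * ρ (n - j) / ρ n)]
    gcongr
    exact two_pow_mul_ratio_le hν0 hν1 hρ h j (by omega)

lemma natDegree_q {K : ℕ} {γ ρ : ℕ → ℝ} (hγ : γ 0 = 1) (hρ : ∀ n, 0 < ρ n) {n : ℕ} (hn : K ≤ n) :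
    (q K γ ρ n).natDegree = n ∧ 0 < (q K γ ρ n).leadingCoeff := by
  have hρn := hρ n
  have hdeg : (C (ρ n) * monicHermite n).degree = n := by
    rw [degree_C_mul hρn.ne', degree_eq_natDegree (monicHermite_monic n).2.ne_zero,
      (monicHermite_monic n).1]
  have hsplit : q K γ ρ n = (∑ j ∈ Finset.range K,
      C (γ (j + 1) * ρ (n - (j + 1))) * monicHermite (n - (j + 1))) +
        C (ρ n) * monicHermite n := by
    rw [q, Finset.sum_range_succ', hγ, one_mul, Nat.sub_zero]
  have hlt : (∑ j ∈ Finset.range K,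
      C (γ (j + 1) * ρ (n - (j + 1))) * monicHermite (n - (j + 1))).degree <
        (C (ρ n) * monicHermite n).degree := by
    rw [hdeg]
    refine (degree_sum_le _ _).trans_lt ((Finset.sup_lt_iff (WithBot.bot_lt_coe n)).2 ?_)
    intro j hj
    rw [Finset.mem_range] at hj
    refine degree_le_natDegree.trans_lt (Nat.cast_lt.2 ((natDegree_C_mul_le _ _).trans_lt ?_))
    rw [(monicHermite_monic _).1]
    omega
  constructor
  · rw [hsplit, natDegree, degree_add_eq_right_of_degree_lt hlt, hdeg]
    rfl
  · rw [hsplit, leadingCoeff_add_of_degree_lt hlt, leadingCoeff_mul, leadingCoeff_C,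
      (monicHermite_monic n).2, mul_one]
    exact hρn

/-- The zeros of `q_n` interlace with those of `H_{n-1}`. -/
lemma exists_isZeroEnum_q {ν : ℝ} (hν0 : 0 ≤ ν) (hν1 : ν ≤ 1 / 4) {K : ℕ} {γ ρ : ℕ → ℝ}
    (hγ : γ 0 = 1) (hρ : ∀ n, 0 < ρ n)
    (h : ∀ n : ℕ, 1 ≤ n → 2 * ρ (n - 1) / ρ n ≤ (n : ℝ) ^ ν) {n : ℕ} (hn : 1 ≤ n)
    (hK : 2 * K ≤ n) (hsmall : (∑ j ∈ Finset.Icc 1 K, |γ j| * 4 ^ j) / √√n < 1) :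
    ∃ x, IsZeroEnum (q K γ ρ n) n x ∧ Interlaces (n - 1) x (hermiteZero (n - 1)) := by
  have hpert := isHermitePerturbation_q hν0 hν1 hγ hρ h hn hK
  obtain ⟨m, rfl⟩ : ∃ m, n = m + 1 := ⟨n - 1, by omega⟩
  obtain ⟨hd, hl⟩ := natDegree_q hγ hρ (show K ≤ m + 1 by omega)
  rw [Nat.add_sub_cancel]
  refine exists_isZeroEnum_of_alternating hd hl (isZeroEnum_hermiteZero m).strictMonoOn ?_
  intro i hi
  have hsign := hermiteZero_sign m i hi
  have hzero := (isZeroEnum_hermiteZero m).eval_eq_zero hi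
  have hsq := sq_hermiteZero_le hi
  have hp := hpert (hermiteZero m i) (by push_cast; linarith)
  -- At a zero of H_{n-1} the bound involves H_n alone, so a relative error below 1 preserves its
  -- sign.
  rw [Nat.add_sub_cancel, hzero, abs_zero, mul_zero, add_zero] at hp
  set u := (physHermite (m + 1)).eval (hermiteZero m i) with hu
  set s := (-1 : ℝ) ^ (m + 1 - i) with hs
  have hs1 : |s| = 1 := by rw [hs, abs_pow, abs_neg, abs_one, one_pow]
  have hu0 : |u| = s * u := by
    rw [← abs_of_pos hsign, abs_mul, hs1, one_mul]
  set v := (C (2 ^ (m + 1) / ρ (m + 1)) * q K γ ρ (m + 1)).eval (hermiteZero m i) with hv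
  have h1 : |s * v - s * u| < s * u := by
    rw [← mul_sub, abs_mul, hs1, one_mul]
    refine hp.trans_lt ?_
    rw [hu0]
    exact mul_lt_of_lt_one_left hsign hsmall
  have h2 : 0 < s * v := by linarith [(abs_lt.1 h1).1]
  rw [hv, eval_mul, eval_C] at h2
  have hc : 0 < 2 ^ (m + 1) / ρ (m + 1) := by have := hρ (m + 1); positivity
  refine pos_of_mul_pos_right (b := s * _) (a := 2 ^ (m + 1) / ρ (m + 1)) ?_ hc.le
  linarith

lemma IsZeroEnum.C_mul {p : ℝ[X]} {n : ℕ} {x : ℕ → ℝ} (h : IsZeroEnum p n x) {a : ℝ}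
    (ha : a ≠ 0) : IsZeroEnum (C a * p) n x :=
  ⟨by rw [natDegree_C_mul ha, h.natDegree_eq], h.strictMonoOn, by
    rw [roots_C_mul p ha, h.roots_eq]⟩

lemma tendsto_div_sqrt_sqrt (B : ℝ) : Tendsto (fun n : ℕ => B / √√(n : ℝ)) atTop (𝓝 0) :=
  Tendsto.const_div_atTop (Real.tendsto_sqrt_atTop.comp
    (Real.tendsto_sqrt_atTop.comp tendsto_natCast_atTop_atTop)) _

lemma isHermiteLike_q {ν : ℝ} (hν0 : 0 ≤ ν) (hν1 : ν ≤ 1 / 4) {K : ℕ} {γ ρ : ℕ → ℝ}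
    (hγ : γ 0 = 1) (hρ : ∀ n, 0 < ρ n)
    (h : ∀ n : ℕ, 1 ≤ n → 2 * ρ (n - 1) / ρ n ≤ (n : ℝ) ^ ν) {x : ℕ → ℕ → ℝ}
    (hx : ∀ᶠ n in atTop, IsZeroEnum (q K γ ρ n) n (x n))
    (hi : ∀ᶠ n in atTop, Interlaces (n - 1) (x n) (hermiteZero (n - 1))) :
    IsHermiteLike (fun n => C (2 ^ n / ρ n) * q K γ ρ n) x where
  ne_zero := by
    filter_upwards [eventually_ge_atTop K] with n hn
    have hρn := hρ n
    refine mul_ne_zero (C_ne_zero.2 (by positivity)) ?_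
    exact leadingCoeff_ne_zero.1 (natDegree_q hγ hρ hn).2.ne'
  isZeroEnum := by
    filter_upwards [hx] with n hn
    have hρn := hρ n
    exact hn.C_mul (by positivity)
  interlaces := hi
  perturbation := by
    refine ⟨fun n => (∑ j ∈ Finset.Icc 1 K, |γ j| * 4 ^ j) / √√n, tendsto_div_sqrt_sqrt _,
      fun n => by positivity, ?_⟩
    filter_upwards [eventually_ge_atTop (2 * K), eventually_ge_atTop 1] with n hK hn
    exact isHermitePerturbation_q hν0 hν1 hγ hρ h hn hK

/-! ### Signs of the zeros -/

section Signs

variable {p : ℝ[X]} {m : ℕ} {x : ℕ → ℝ}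

/-- The middle zero of H_{2m-1} is 0 and separates zeros `m` and `m + 1` of `p`. -/
lemma numPos_numNeg_even (hm : 1 ≤ m) (h : IsZeroEnum p (2 * m) x)
    (hi : Interlaces (2 * m - 1) x (hermiteZero (2 * m - 1))) :
    numPos p = m ∧ numNeg p = m := by
  obtain ⟨l, rfl⟩ : ∃ l, m = l + 1 := ⟨m - 1, by omega⟩
  have h0 := hi (l + 1) (Finset.mem_Icc.2 ⟨by omega, by omega⟩)
  rw [show 2 * (l + 1) - 1 = 2 * l + 1 by omega, hermiteZero_middle] at h0
  have hneg : ∀ j ∈ Finset.Icc 1 (l + 1), x j < 0 := fun j hj => by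
    rw [Finset.mem_Icc] at hj
    exact (h.le hj.1 hj.2 (by omega)).trans_lt h0.1
  have hpos : ∀ j ∈ Finset.Icc (l + 1 + 1) (2 * (l + 1)), 0 < x j := fun j hj => by
    rw [Finset.mem_Icc] at hj
    exact h0.2.trans_le (h.le (by omega) hj.1 hj.2)
  constructor
  · rw [h.numPos_eq (a := l + 1) (by omega) (fun j hj => (hneg j hj).le) hpos]
    omega
  · exact h.numNeg_eq (by omega) hneg (fun j hj => (hpos j hj).le)

/-- The two innermost zeros of H_{2m} have opposite signs and enclose a single zero of `p`; only
that one has undecided sign. -/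
lemma zero_signs_odd (hm : 1 ≤ m) (h : IsZeroEnum p (2 * m + 1) x)
    (hi : Interlaces (2 * m) x (hermiteZero (2 * m))) :
    (∀ j ∈ Finset.Icc 1 m, x j < 0) ∧ ∀ j ∈ Finset.Icc (m + 2) (2 * m + 1), 0 < x j := by
  obtain ⟨h1, h2⟩ := hermiteZero_even_signs hm
  have h3 := (hi m (Finset.mem_Icc.2 ⟨hm, by omega⟩)).1
  have h4 := (hi (m + 1) (Finset.mem_Icc.2 ⟨by omega, by omega⟩)).2
  constructor
  · intro j hj
    rw [Finset.mem_Icc] at hj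
    exact ((h.le hj.1 hj.2 (by omega)).trans_lt h3).trans h1
  · intro j hj
    rw [Finset.mem_Icc] at hj
    exact h2.trans (h4.trans_le (h.le (by omega) hj.1 hj.2))

lemma numPos_numNeg_odd (hm : 1 ≤ m) (h : IsZeroEnum p (2 * m + 1) x)
    (hi : Interlaces (2 * m) x (hermiteZero (2 * m))) :
    (0 < x (m + 1) → numPos p = m + 1 ∧ numNeg p = m) ∧
    (x (m + 1) < 0 → numPos p = m ∧ numNeg p = m + 1) ∧
    (x (m + 1) = 0 → numPos p = m ∧ numNeg p = m) := by
  obtain ⟨hneg, hpos⟩ := zero_signs_odd hm h hi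
  have hle : ∀ {P : ℝ → Prop}, P (x (m + 1)) → (∀ j ∈ Finset.Icc 1 m, P (x j)) →
      ∀ j ∈ Finset.Icc 1 (m + 1), P (x j) := by
    intro P h1 h2 j hj
    rw [Finset.mem_Icc] at hj
    rcases hj.2.eq_or_lt with rfl | hlt
    · exact h1
    · exact h2 j (Finset.mem_Icc.2 ⟨hj.1, by omega⟩)
  have hge : ∀ {P : ℝ → Prop}, P (x (m + 1)) →
      (∀ j ∈ Finset.Icc (m + 2) (2 * m + 1), P (x j)) →
      ∀ j ∈ Finset.Icc (m + 1) (2 * m + 1), P (x j) := by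
    intro P h1 h2 j hj
    rw [Finset.mem_Icc] at hj
    rcases hj.1.eq_or_lt with rfl | hlt
    · exact h1
    · exact h2 j (Finset.mem_Icc.2 ⟨by omega, hj.2⟩)
  have hneg' : ∀ j ∈ Finset.Icc 1 m, x j ≤ 0 := fun j hj => (hneg j hj).le
  have hpos' : ∀ j ∈ Finset.Icc (m + 2) (2 * m + 1), 0 ≤ x j := fun j hj => (hpos j hj).le
  refine ⟨fun h0 => ⟨?_, ?_⟩, fun h0 => ⟨?_, ?_⟩, fun h0 => ⟨?_, ?_⟩⟩
  · rw [h.numPos_eq (a := m) (by omega) hneg' (hge (P := fun t => 0 < t) h0 hpos)]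
    omega
  · exact h.numNeg_eq (by omega) hneg (hge (P := fun t => 0 ≤ t) h0.le hpos')
  · rw [h.numPos_eq (a := m + 1) (by omega) (hle (P := fun t => t ≤ 0) h0.le hneg') hpos]
    omega
  · exact h.numNeg_eq (by omega) (hle (P := fun t => t < 0) h0 hneg) hpos'
  · rw [h.numPos_eq (a := m + 1) (by omega) (hle (P := fun t => t ≤ 0) h0.le hneg') hpos]
    omega
  · exact h.numNeg_eq (by omega) hneg (hge (P := fun t => 0 ≤ t) h0.ge hpos')

/-- The sign of the middle zero is determined by the value at `0`. -/
lemma middle_zero_sign (hm : 1 ≤ m) (h : IsZeroEnum p (2 * m + 1) x) (hp : 0 < p.leadingCoeff)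
    (hi : Interlaces (2 * m) x (hermiteZero (2 * m))) :
    (0 < x (m + 1) → 0 < (-1) ^ (m + 1) * p.eval 0) ∧
    (x (m + 1) < 0 → (-1) ^ (m + 1) * p.eval 0 < 0) ∧
    (x (m + 1) = 0 → p.eval 0 = 0) := by
  obtain ⟨hneg, hpos⟩ := zero_signs_odd hm h hi
  refine ⟨fun h0 => ?_, fun h0 => ?_, fun h0 => ?_⟩
  · have := h.eval_sign hp (i := m) (z := 0) (by omega) hneg (fun j hj => ?_)
    · rwa [show 2 * m + 1 - m = m + 1 by omega] at this
    · rw [Finset.mem_Icc] at hj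
      exact h0.trans_le (h.le (by omega) hj.1 hj.2)
  · have := h.eval_sign hp (i := m + 1) (z := 0) (by omega) (fun j hj => ?_) hpos
    · rw [show 2 * m + 1 - (m + 1) = m by omega] at this
      rw [pow_succ]
      linarith
    · rw [Finset.mem_Icc] at hj
      exact (h.le hj.1 hj.2 (by omega)).trans_lt h0
  · have := h.eval_eq_zero (i := m + 1) (Finset.mem_Icc.2 ⟨by omega, by omega⟩)
    rwa [h0] at this

end Signs

/-- The sign of `∑ γ_j H_{n-j}` at the origin for large odd `n`. -/
lemma eventually_sum_eval_zero_sign (K : ℕ) (γ : ℕ → ℝ) :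
    ∃ N, ∀ m : ℕ, N ≤ 2 * m + 1 →
      (chi K γ ≠ 0 → 0 < chi K γ * ((-1) ^ (m + 1) *
        ∑ j ∈ Finset.range (K + 1), γ j * (physHermite (2 * m + 1 - j)).eval 0)) ∧
      (chi K γ = 0 →
        ∑ j ∈ Finset.range (K + 1), γ j * (physHermite (2 * m + 1 - j)).eval 0 = 0) := by
  classical
  by_cases h : ∃ i : ℕ, 2 * i + 1 ≤ K ∧ γ (2 * i + 1) ≠ 0
  swap
  · have hchi : chi K γ = 0 := by rw [chi, dif_neg h]
    -- At even index the Hermite polynomial has odd degree and vanishes at 0; at odd index the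
    -- coefficient vanishes.
    refine ⟨K, fun m hm => ⟨fun h0 => absurd hchi h0, fun _ => Finset.sum_eq_zero fun j hj => ?_⟩⟩
    rw [Finset.mem_range] at hj
    rcases Nat.even_or_odd' j with ⟨l, rfl | rfl⟩
    · rw [show 2 * m + 1 - 2 * l = 2 * (m - l) + 1 by omega, eval_zero_physHermite_odd, mul_zero]
    · push Not at h
      rw [h l (by omega), zero_mul]
  · have hchi : chi K γ = (-1) ^ (Nat.find h + 1) * γ (2 * Nat.find h + 1) := by
      rw [chi, dif_pos h]
    obtain ⟨hiK, hγi⟩ := Nat.find_spec h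
    have hmin : ∀ l < Nat.find h, γ (2 * l + 1) = 0 := fun l hl => by
      by_contra hne
      exact Nat.find_min h hl ⟨by omega, hne⟩
    generalize Nat.find h = i at hchi hiK hγi hmin
    set B := ∑ j ∈ Finset.Icc 1 (K - (2 * i + 1)), |γ (2 * i + 1 + j)| * 4 ^ j with hB
    obtain ⟨N, hN⟩ := eventually_atTop.1
      ((tendsto_div_sqrt_sqrt B).eventually_lt_const (abs_pos.2 hγi))
    -- The term 3K absorbs the shift by 2i + 1 and leaves 2(K - (2i + 1)) ≤ 2l.
    refine ⟨N + 3 * K + 1, fun m hm => ?_⟩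
    have hchi0 : chi K γ ≠ 0 := by
      rw [hchi]; exact mul_ne_zero (by positivity) hγi
    refine ⟨fun _ => ?_, fun h0 => absurd h0 hchi0⟩
    obtain ⟨l, rfl⟩ : ∃ l, m = i + l := ⟨m - i, by omega⟩
    -- All terms before index 2i + 1 vanish at 0, so the sum effectively starts at H_{2l} and its
    -- tail falls under `abs_sum_physHermite_le`.
    have hsum : ∑ j ∈ Finset.range (K + 1), γ j * (physHermite (2 * (i + l) + 1 - j)).eval 0 =
        γ (2 * i + 1) * (physHermite (2 * l)).eval 0 + ∑ j ∈ Finset.Icc 1 (K - (2 * i + 1)),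
          γ (2 * i + 1 + j) * (physHermite (2 * l - j)).eval 0 := by
      rw [show K + 1 = 2 * i + 1 + (K - (2 * i + 1) + 1) by omega, Finset.sum_range_add,
        Finset.sum_eq_zero, zero_add, sum_range_succ_eq_add_sum_Icc]
      · congr 1
        · congr 3; omega
        · refine Finset.sum_congr rfl fun j _ => ?_
          congr 3; omega
      · intro j hj
        rw [Finset.mem_range] at hj
        rcases Nat.even_or_odd' j with ⟨a, rfl | rfl⟩
        · rw [show 2 * (i + l) + 1 - 2 * a = 2 * (i + l - a) + 1 by omega,
            eval_zero_physHermite_odd, mul_zero]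
        · rw [hmin a (by omega), zero_mul]
    have hr1 : (1 : ℝ) ≤ √√((2 * l : ℕ) : ℝ) := by
      rw [Real.one_le_sqrt, Real.one_le_sqrt]
      exact_mod_cast (by omega : 1 ≤ 2 * l)
    have hbound := abs_sum_physHermite_le (n := 2 * l) (K := K - (2 * i + 1)) (z := 0) (by omega)
      (by omega) (c := fun j => γ (2 * i + 1 + j)) (γ := fun j => γ (2 * i + 1 + j))
      (fun j _ => le_mul_of_one_le_right (abs_nonneg _) (one_le_pow₀ hr1)) (by simp)
    -- With H_{2l-1}(0) = 0 the tail is compared with H_{2l}(0) alone.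
    have hodd : (physHermite (2 * l - 1)).eval 0 = 0 := by
      rw [show 2 * l - 1 = 2 * (l - 1) + 1 by omega, eval_zero_physHermite_odd]
    rw [hodd, abs_zero, mul_zero, add_zero, ← hB] at hbound
    have hsmall := hN (2 * l) (by omega)
    rw [hsum, hchi]
    set T := ∑ j ∈ Finset.Icc 1 (K - (2 * i + 1)),
          γ (2 * i + 1 + j) * (physHermite (2 * l - j)).eval 0 with hT
    have hP := eval_zero_physHermite_even_pos l
    set P := (physHermite (2 * l)).eval 0 with hPdef
    set g := γ (2 * i + 1) with hg
    have hPabs : |P| = (-1) ^ l * P := by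
      rw [← abs_of_pos hP, abs_mul, abs_pow, abs_neg, abs_one, one_pow, one_mul]
    have hPpos : 0 < |P| := hPabs ▸ hP
    have hT' : |T| < |g| * |P| := hbound.trans_lt (mul_lt_mul_of_pos_right hsmall hPpos)
    have hsgn : ((-1 : ℝ) ^ (i + 1)) * (-1) ^ (i + l + 1) = (-1) ^ l := by
      rw [← pow_add, show i + 1 + (i + l + 1) = 2 * (i + 1) + l by ring, pow_add, pow_mul]
      norm_num
    have e : (-1) ^ (i + 1) * g * ((-1) ^ (i + l + 1) * (g * P + T)) =
        g * g * ((-1) ^ l * P) + (-1) ^ l * (g * T) := by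
      rw [← hsgn]; ring
    rw [e, ← hPabs, ← abs_mul_abs_self g]
    have h3 : |(-1) ^ l * (g * T)| < |g| * (|g| * |P|) := by
      rw [abs_mul, abs_pow, abs_neg, abs_one, one_pow, one_mul, abs_mul]
      exact mul_lt_mul_of_pos_left hT' (abs_pos.2 hγi)
    have := (abs_lt.1 h3).1
    linarith

/-! ### Power sums of the zeros of Hermite polynomials -/

/-- Stieltjes' relation; the term `j = i` vanishes since `0⁻¹ = 0`. -/
lemma hermiteZero_eq_sum_inv {n i : ℕ} (hi : i ∈ Finset.Icc 1 n) :
    hermiteZero n i = ∑ j ∈ Finset.Icc 1 n, (hermiteZero n i - hermiteZero n j)⁻¹ := by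
  have h := isZeroEnum_hermiteZero n
  set x := hermiteZero n with hx
  set c := (physHermite n).leadingCoeff with hc
  have hc0 : c ≠ 0 := (physHermite_leadingCoeff_pos n).ne'
  set S := (Finset.Icc 1 n).erase i with hS
  set g : ℝ[X] := C c * ∏ j ∈ S, (X - C (x j)) with hg
  have hne : ∀ j ∈ S, x i - x j ≠ 0 := by
    intro j hj
    rw [hS, Finset.mem_erase, Finset.mem_Icc] at hj
    rw [Finset.mem_Icc] at hi
    exact sub_ne_zero.2 fun heq => hj.1 (h.strictMonoOn.injOn hi hj.2 heq).symm
  -- With H_n = (X - x_i) g one has H_n' = g and H_n'' = 2g' at x_i, and the differential equation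
  -- becomes g'/g = x_i.
  have hp : physHermite n = (X - C (x i)) * g := by
    rw [hg, mul_left_comm, Finset.mul_prod_erase (Finset.Icc 1 n) (fun j => X - C (x j)) hi]
    exact h.eq_prod
  have hd1 : (derivative (physHermite n)).eval (x i) = g.eval (x i) := by
    rw [hp]; simp
  have hd2 : (derivative (derivative (physHermite n))).eval (x i) =
      2 * (derivative g).eval (x i) := by
    rw [hp]; simp; ring
  have hode := eval_derivative_derivative_physHermite n (x i)
  rw [h.eval_eq_zero hi, hd1, hd2] at hode
  have hgx : g.eval (x i) = c * ∏ j ∈ S, (x i - x j) := by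
    simp [hg, eval_prod]
  have hg0 : g.eval (x i) ≠ 0 := by
    rw [hgx]
    exact mul_ne_zero hc0 (Finset.prod_ne_zero_iff.2 hne)
  have hdg : (derivative g).eval (x i) = g.eval (x i) * ∑ j ∈ S, (x i - x j)⁻¹ := by
    rw [hgx, hg, derivative_C_mul, eval_mul, eval_C, derivative_prod_finset, eval_finsetSum,
      mul_assoc]
    congr 1
    rw [Finset.mul_sum]
    refine Finset.sum_congr rfl fun j hj => ?_
    rw [← Finset.mul_prod_erase S (fun j => x i - x j) hj]
    have := hne j hj
    simp only [derivative_sub, derivative_X, derivative_C, sub_zero, eval_mul, eval_prod, eval_sub,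
      eval_X, eval_C, eval_one]
    field_simp
  rw [hdg] at hode
  have hfin : x i = ∑ j ∈ S, (x i - x j)⁻¹ := by
    have : g.eval (x i) * (∑ j ∈ S, (x i - x j)⁻¹ - x i) = 0 := by linarith
    linarith [(mul_eq_zero.1 this).resolve_left hg0]
  rw [← Finset.add_sum_erase _ _ hi, sub_self, inv_zero, zero_add]
  exact hfin

/-- The power sums of the zeros of `H_n`. -/
noncomputable def powerSum (n p : ℕ) : ℝ := ∑ i ∈ Finset.Icc 1 n, hermiteZero n i ^ p

/-- Stieltjes' relation times x_i^p is summed and symmetrised in (i, j), where (x_i^p - x_j^p)/(x_i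
- x_j) is a geometric sum. Adding the diagonal to complete the products costs the subtracted term.
For p = 0 the truncated p - 1 is harmless. -/
lemma two_mul_powerSum_succ (n p : ℕ) :
    2 * powerSum n (p + 1) =
      ∑ a ∈ Finset.range p, powerSum n a * powerSum n (p - 1 - a) - p * powerSum n (p - 1) := by
  have h := isZeroEnum_hermiteZero n
  set I := Finset.Icc 1 n with hI
  set x := hermiteZero n with hx
  have h1 : powerSum n (p + 1) = ∑ i ∈ I, ∑ j ∈ I, x i ^ p * (x i - x j)⁻¹ := by
    rw [powerSum]
    refine Finset.sum_congr rfl fun i hi => ?_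
    rw [← Finset.mul_sum, ← hermiteZero_eq_sum_inv hi, pow_succ]
  have h2 : powerSum n (p + 1) = ∑ i ∈ I, ∑ j ∈ I, -(x j ^ p * (x i - x j)⁻¹) := by
    rw [h1, Finset.sum_comm]
    refine Finset.sum_congr rfl fun i _ => Finset.sum_congr rfl fun j _ => ?_
    rw [← neg_sub (x i) (x j), inv_neg, mul_neg]
  have h3 : ∀ i ∈ I, ∀ j ∈ I, x i ^ p * (x i - x j)⁻¹ + -(x j ^ p * (x i - x j)⁻¹) =
      ∑ a ∈ Finset.range p, x i ^ a * x j ^ (p - 1 - a) -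
        if i = j then p * x i ^ (p - 1) else 0 := by
    intro i hi j hj
    by_cases hij : i = j
    · subst hij
      rw [if_pos rfl, sub_self, inv_zero, Finset.sum_congr rfl (g := fun _ => x i ^ (p - 1))]
      · simp
      · intro a ha
        rw [Finset.mem_range] at ha
        rw [← pow_add]
        congr 1
        omega
    · rw [if_neg hij, sub_zero]
      have hne : x i - x j ≠ 0 := sub_ne_zero.2 fun heq =>
        hij (h.strictMonoOn.injOn (Finset.mem_Icc.1 hi) (Finset.mem_Icc.1 hj) heq)
      have := (Commute.all (x i) (x j)).geom_sum₂_mul p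
      field_simp
      linarith
  have h4 : 2 * powerSum n (p + 1) = ∑ i ∈ I, ∑ j ∈ I,
      (∑ a ∈ Finset.range p, x i ^ a * x j ^ (p - 1 - a) -
        if i = j then p * x i ^ (p - 1) else 0) := by
    rw [two_mul]
    nth_rewrite 1 [h1]
    rw [h2, ← Finset.sum_add_distrib]
    refine Finset.sum_congr rfl fun i hi => ?_
    rw [← Finset.sum_add_distrib]
    exact Finset.sum_congr rfl fun j hj => h3 i hi j hj
  rw [h4]
  simp only [Finset.sum_sub_distrib]
  congr 1
  · simp only [powerSum, Finset.sum_mul_sum]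
    rw [Finset.sum_comm (s := Finset.range p)]
    exact Finset.sum_congr rfl fun i _ => Finset.sum_comm
  · rw [powerSum, Finset.mul_sum]
    refine Finset.sum_congr rfl fun i hi => ?_
    rw [Finset.sum_ite_eq, if_pos hi]

/-- The moments of the zeros of `H_n`, scaled by `√(2n)`. -/
noncomputable def zeroMoment (n p : ℕ) : ℝ :=
  (1 / (n : ℝ)) * ∑ i ∈ Finset.Icc 1 n, (hermiteZero n i / √(2 * (n : ℝ))) ^ p

lemma zeroMoment_eq (n p : ℕ) : zeroMoment n p = powerSum n p / (n * √(2 * (n : ℝ)) ^ p) := by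
  simp only [zeroMoment, powerSum, div_pow, ← Finset.sum_div]
  rw [div_mul_div_comm, one_mul]

lemma zeroMoment_zero {n : ℕ} (hn : 1 ≤ n) : zeroMoment n 0 = 1 := by
  have : (n : ℝ) ≠ 0 := by positivity
  simp [zeroMoment, this]

lemma zeroMoment_one (n : ℕ) : zeroMoment n 1 = 0 := by
  have := two_mul_powerSum_succ n 0
  simp at this
  rw [zeroMoment_eq, this, zero_div]

/-- Apart from the 1/n term this is the recursion of `semicircleMoment_add_two`. -/
lemma zeroMoment_add_two {n : ℕ} (hn : 1 ≤ n) (r : ℕ) :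
    zeroMoment n (r + 2) =
      1 / 4 * ∑ a ∈ Finset.range (r + 1), zeroMoment n a * zeroMoment n (r - a) -
        (r + 1) / 4 * (1 / (n : ℝ)) * zeroMoment n r := by
  have hn0 : (0 : ℝ) < n := by positivity
  have h := two_mul_powerSum_succ n (r + 1)
  simp only [Nat.add_sub_cancel] at h
  have hs : 0 < √(2 * (n : ℝ)) := Real.sqrt_pos.2 (by positivity)
  have hs2 : √(2 * (n : ℝ)) ^ 2 = 2 * n := Real.sq_sqrt (by positivity)
  simp only [zeroMoment_eq]
  set s := √(2 * (n : ℝ))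
  have hsum : ∑ a ∈ Finset.range (r + 1), powerSum n a / (n * s ^ a) *
      (powerSum n (r - a) / (n * s ^ (r - a))) =
      (∑ a ∈ Finset.range (r + 1), powerSum n a * powerSum n (r - a)) / (n ^ 2 * s ^ r) := by
    rw [Finset.sum_div]
    refine Finset.sum_congr rfl fun a ha => ?_
    rw [Finset.mem_range] at ha
    rw [div_mul_div_comm]
    congr 1
    have : s ^ r = s ^ a * s ^ (r - a) := by rw [← pow_add]; congr 1; omega
    rw [this]
    ring
  rw [hsum, pow_add, hs2]
  have e : powerSum n (r + 2) = (∑ a ∈ Finset.range (r + 1), powerSum n a * powerSum n (r - a) -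
      ((r + 1 : ℕ) : ℝ) * powerSum n r) / 2 := by
    rw [← h]; ring
  rw [e]
  push_cast
  field_simp
  ring

/-! ### Moments of the semicircle law -/

/-- The moments of the semicircle law on `[-1, 1]`. -/
noncomputable def semicircleMoment (p : ℕ) : ℝ :=
  2 / Real.pi * ∫ x in (-1 : ℝ)..1, x ^ p * √(1 - x ^ 2)

/-- Integrates the derivative of x^(p+1) (1 - x²)^(3/2), a function vanishing at ±1. -/
lemma integral_pow_mul_sqrt_add_two (p : ℕ) :
    (p + 4 : ℝ) * ∫ x in (-1 : ℝ)..1, x ^ (p + 2) * √(1 - x ^ 2) =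
      (p + 1 : ℝ) * ∫ x in (-1 : ℝ)..1, x ^ p * √(1 - x ^ 2) := by
  have hderiv : ∀ x ∈ Set.Ioo (-1 : ℝ) 1,
      HasDerivAt (fun x : ℝ => x ^ (p + 1) * ((1 - x ^ 2) * √(1 - x ^ 2)))
        ((p + 1 : ℝ) * (x ^ p * √(1 - x ^ 2)) - (p + 4 : ℝ) * (x ^ (p + 2) * √(1 - x ^ 2))) x := by
    intro x hx
    have hpos : 0 < 1 - x ^ 2 := by nlinarith [hx.1, hx.2]
    have h1 : HasDerivAt (fun x : ℝ => 1 - x ^ 2) (-(2 * x)) x :=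
      ((hasDerivAt_pow 2 x).const_sub 1).congr_deriv (by norm_num)
    have h2 := h1.sqrt hpos.ne'
    refine ((hasDerivAt_pow (p + 1) x).fun_mul (h1.fun_mul h2)).congr_deriv ?_
    have hs : 0 < √(1 - x ^ 2) := Real.sqrt_pos.2 hpos
    have hs2 : √(1 - x ^ 2) ^ 2 = 1 - x ^ 2 := Real.sq_sqrt hpos.le
    rw [← hs2]
    simp only [Nat.add_sub_cancel, Nat.cast_add, Nat.cast_one]
    have h3 : √(1 - x ^ 2) ^ 3 = (1 - x ^ 2) * √(1 - x ^ 2) := by rw [pow_succ, hs2]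
    field_simp
    rw [show √(√(1 - x ^ 2) ^ 2) = √(1 - x ^ 2) from Real.sqrt_sq hs.le]
    rw [hs2]
    ring
  have hcont : ∀ p : ℕ, Continuous fun x : ℝ => x ^ p * √(1 - x ^ 2) := fun p => by fun_prop
  have hint : ∀ p : ℕ, IntervalIntegrable (fun x : ℝ => x ^ p * √(1 - x ^ 2))
      MeasureTheory.volume (-1) 1 := fun p => (hcont p).intervalIntegrable _ _
  have h := intervalIntegral.integral_eq_sub_of_hasDerivAt_of_le (by norm_num : (-1 : ℝ) ≤ 1)
    (by fun_prop) hderiv (((hint p).const_mul _).sub ((hint (p + 2)).const_mul _))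
  rw [intervalIntegral.integral_sub ((hint p).const_mul _) ((hint (p + 2)).const_mul _),
    intervalIntegral.integral_const_mul, intervalIntegral.integral_const_mul] at h
  norm_num at h
  linarith

lemma semicircleMoment_odd (k : ℕ) : semicircleMoment (2 * k + 1) = 0 := by
  have h : ∫ x in (-1 : ℝ)..1, x ^ (2 * k + 1) * √(1 - x ^ 2) =
      -∫ x in (-1 : ℝ)..1, x ^ (2 * k + 1) * √(1 - x ^ 2) := by
    have h1 := intervalIntegral.integral_comp_neg (a := (-1 : ℝ)) (b := 1)
      (fun x : ℝ => x ^ (2 * k + 1) * √(1 - x ^ 2))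
    rw [neg_neg] at h1
    nth_rewrite 1 [← h1]
    rw [← intervalIntegral.integral_neg]
    refine intervalIntegral.integral_congr fun x _ => ?_
    rw [Odd.neg_pow ⟨k, rfl⟩, neg_sq]
    ring
  rw [semicircleMoment, show ∫ x in (-1 : ℝ)..1, x ^ (2 * k + 1) * √(1 - x ^ 2) = 0 by linarith,
    mul_zero]

lemma add_two_mul_catalan_succ (k : ℕ) :
    (k + 2 : ℝ) * catalan (k + 1) = 2 * (2 * k + 1) * catalan k := by
  have h1 := succ_mul_catalan_eq_centralBinom (k + 1)
  have h2 := Nat.succ_mul_centralBinom_succ k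
  rw [← h1, ← succ_mul_catalan_eq_centralBinom k] at h2
  have h3 : ((k : ℝ) + 1) * ((k + 2 : ℝ) * catalan (k + 1)) =
      (k + 1) * (2 * (2 * k + 1) * catalan k) := by
    have h4 : (((k + 1) * ((k + 1 + 1) * catalan (k + 1)) : ℕ) : ℝ) =
      ((2 * (2 * k + 1) * ((k + 1) * catalan k) : ℕ) : ℝ) := by exact_mod_cast h2
    push_cast at h4
    linarith
  exact mul_left_cancel₀ (by positivity) h3

lemma semicircleMoment_even (k : ℕ) : semicircleMoment (2 * k) = catalan k / 4 ^ k := by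
  induction k with
  | zero =>
    simp only [semicircleMoment, mul_zero, pow_zero, one_mul, integral_sqrt_one_sub_sq]
    have := Real.pi_pos
    simp
  | succ k ih =>
    have h := integral_pow_mul_sqrt_add_two (2 * k)
    have h1 : (2 * k + 4 : ℝ) * semicircleMoment (2 * (k + 1)) =
        (2 * k + 1) * semicircleMoment (2 * k) := by
      push_cast at h
      rw [semicircleMoment, semicircleMoment, show 2 * (k + 1) = 2 * k + 2 by ring,
        mul_left_comm, h, mul_left_comm]
    rw [ih] at h1
    have h2 := add_two_mul_catalan_succ k
    have h3 : (2 * k + 4 : ℝ) * semicircleMoment (2 * (k + 1)) =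
        (2 * k + 4) * (catalan (k + 1) / 4 ^ (k + 1)) := by
      rw [h1, pow_succ]
      field_simp
      linarith
    exact mul_left_cancel₀ (by positivity) h3

lemma sum_range_eq_sum_even {F : ℕ → ℝ} (hF : ∀ b, F (2 * b + 1) = 0) (k : ℕ) :
    ∑ a ∈ Finset.range (2 * k + 1), F a = ∑ b ∈ Finset.range (k + 1), F (2 * b) := by
  induction k with
  | zero => simp
  | succ k ih =>
    rw [show 2 * (k + 1) + 1 = 2 * k + 1 + 1 + 1 by ring, Finset.sum_range_succ,
      Finset.sum_range_succ, ih, hF, add_zero, Finset.sum_range_succ _ (k + 1)]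
    rfl

/-- The Catalan convolution, once the vanishing odd moments are discarded. -/
lemma semicircleMoment_add_two (r : ℕ) :
    semicircleMoment (r + 2) =
      1 / 4 * ∑ a ∈ Finset.range (r + 1), semicircleMoment a * semicircleMoment (r - a) := by
  rcases Nat.even_or_odd' r with ⟨k, rfl | rfl⟩
  · rw [sum_range_eq_sum_even (fun b => by rw [semicircleMoment_odd, zero_mul]),
      show 2 * k + 2 = 2 * (k + 1) by ring, semicircleMoment_even, catalan_succ,
      ← Finset.sum_range (fun i => catalan i * catalan (k - i))]
    push_cast
    rw [Finset.sum_div, Finset.mul_sum]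
    refine Finset.sum_congr rfl fun b hb => ?_
    rw [Finset.mem_range] at hb
    rw [← Nat.mul_sub, semicircleMoment_even, semicircleMoment_even, pow_succ]
    have : (4 : ℝ) ^ k = 4 ^ b * 4 ^ (k - b) := by rw [← pow_add]; congr 1; omega
    rw [this]
    field_simp
  · rw [show 2 * k + 1 + 2 = 2 * (k + 1) + 1 by ring, semicircleMoment_odd, Finset.sum_eq_zero,
      mul_zero]
    intro a ha
    rw [Finset.mem_range] at ha
    rcases Nat.even_or_odd' a with ⟨b, rfl | rfl⟩
    · rw [show 2 * k + 1 - 2 * b = 2 * (k - b) + 1 by omega, semicircleMoment_odd, mul_zero]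
    · rw [semicircleMoment_odd, zero_mul]

/-- Both moment sequences share the initial values and, in the limit, the recursion. -/
lemma tendsto_zeroMoment (p : ℕ) :
    Tendsto (fun n => zeroMoment n p) atTop (𝓝 (semicircleMoment p)) := by
  induction p using Nat.strong_induction_on with
  | _ p ih =>
    match p, ih with
    | 0, _ =>
      have : semicircleMoment 0 = 1 := by simpa using semicircleMoment_even 0
      rw [this]
      refine tendsto_const_nhds.congr' ?_
      filter_upwards [eventually_ge_atTop 1] with n hn
      rw [zeroMoment_zero hn]
    | 1, _ =>
      have : semicircleMoment 1 = 0 := semicircleMoment_odd 0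
      rw [this]
      exact tendsto_const_nhds.congr fun n => (zeroMoment_one n).symm
    | r + 2, ih =>
      have h1 : Tendsto (fun n => ∑ a ∈ Finset.range (r + 1), zeroMoment n a * zeroMoment n (r - a))
          atTop (𝓝 (∑ a ∈ Finset.range (r + 1),
            semicircleMoment a * semicircleMoment (r - a))) := by
        refine tendsto_finsetSum _ fun a ha => ?_
        rw [Finset.mem_range] at ha
        exact (ih a (by omega)).mul (ih (r - a) (by omega))
      have h2 : Tendsto (fun n : ℕ => (r + 1) / 4 * (1 / (n : ℝ)) * zeroMoment n r) atTop
          (𝓝 ((r + 1) / 4 * 0 * semicircleMoment r)) :=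
        (tendsto_one_div_atTop_nhds_zero_nat.const_mul _).mul (ih r (by omega))
      have h3 := (h1.const_mul (1 / 4)).sub h2
      rw [mul_zero, zero_mul, sub_zero, ← semicircleMoment_add_two] at h3
      refine h3.congr' ?_
      filter_upwards [eventually_ge_atTop 1] with n hn
      rw [zeroMoment_add_two hn]

lemma tendsto_average_polynomial (P : ℝ[X]) :
    Tendsto (fun n : ℕ => (1 / (n : ℝ)) *
      ∑ i ∈ Finset.Icc 1 n, P.eval (hermiteZero n i / √(2 * (n : ℝ)))) atTop
      (𝓝 (2 / Real.pi * ∫ x in (-1 : ℝ)..1, P.eval x * √(1 - x ^ 2))) := by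
  induction P using Polynomial.induction_on' with
  | add P Q hP hQ =>
    have h := hP.add hQ
    simp only [eval_add, add_mul, Finset.sum_add_distrib, mul_add] at h ⊢
    rwa [intervalIntegral.integral_add, mul_add]
    · exact Continuous.intervalIntegrable (by fun_prop) _ _
    · exact Continuous.intervalIntegrable (by fun_prop) _ _
  | monomial p a =>
    have h := (tendsto_zeroMoment p).const_mul a
    simp only [eval_monomial, mul_assoc a, intervalIntegral.integral_const_mul]
    simp only [zeroMoment, semicircleMoment] at h
    rw [mul_left_comm]
    refine h.congr fun n => ?_
    rw [← Finset.mul_sum, mul_left_comm]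

/-! ### The semicircle law for the zeros of Hermite-like families -/

lemma exists_lipschitz_polynomial (P : ℝ[X]) :
    ∃ L, 0 ≤ L ∧ ∀ x ∈ Set.Icc (-1 : ℝ) 1, ∀ y ∈ Set.Icc (-1 : ℝ) 1,
      |P.eval x - P.eval y| ≤ L * |x - y| := by
  obtain ⟨L, hL⟩ := (isCompact_Icc (a := (-1 : ℝ)) (b := 1)).exists_bound_of_continuousOn
    (f := fun x => (derivative P).eval x) (by fun_prop)
  refine ⟨L, (norm_nonneg _).trans (hL 0 (by norm_num)), fun x hx y hy => ?_⟩
  exact (convex_Icc (-1 : ℝ) 1).norm_image_sub_le_of_norm_hasDerivWithin_le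
    (fun t _ => (P.hasDerivAt t).hasDerivWithinAt) hL hy hx

lemma sum_Icc_eq_sum_range (F : ℕ → ℝ) (k : ℕ) :
    ∑ j ∈ Finset.Icc 1 (k + 2), F j = F 1 + ∑ j ∈ Finset.range k, F (j + 2) + F (k + 2) := by
  rw [Finset.range_eq_Ico, Finset.sum_Ico_add' F 0 k 2]
  have h : Finset.Icc 1 (k + 2) = Finset.Ico 1 (k + 2 + 1) := rfl
  rw [h, Finset.sum_Ico_succ_top (by omega), Finset.sum_eq_sum_Ico_succ_bot (by omega), zero_add]

/-- Comparison of averages over two sequences interlacing with the zeros of `H_{n-1}`. -/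
lemma abs_average_sub_le {k : ℕ} {x : ℕ → ℝ}
    (hx : Interlaces (k + 1) x (hermiteZero (k + 1))) {f P : ℝ → ℝ} {ε L M : ℝ} (hL : 0 ≤ L)
    (hM : ∀ t, |f t| ≤ M) (hfP : ∀ t ∈ Set.Icc (-1 : ℝ) 1, |f t - P t| ≤ ε)
    (hP : ∀ s ∈ Set.Icc (-1 : ℝ) 1, ∀ t ∈ Set.Icc (-1 : ℝ) 1, |P s - P t| ≤ L * |s - t|) :
    |∑ j ∈ Finset.Icc 1 (k + 2), (f (x j / √(2 * ((k + 2 : ℕ) : ℝ))) -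
      P (hermiteZero (k + 2) j / √(2 * ((k + 2 : ℕ) : ℝ))))| ≤
      k * ε + 2 * L + 2 * (2 * M + ε) := by
  set s := √(2 * ((k + 2 : ℕ) : ℝ)) with hs
  have hs0 : 0 < s := Real.sqrt_pos.2 (by positivity)
  have hs2 : s ^ 2 = 2 * ((k + 2 : ℕ) : ℝ) := Real.sq_sqrt (by positivity)
  set y := hermiteZero (k + 1) with hy
  set w := hermiteZero (k + 2) with hw
  have hwi : Interlaces (k + 1) w y := interlaces_hermiteZero (k + 1)
  have hmem : ∀ t : ℝ, t ^ 2 ≤ s ^ 2 → t / s ∈ Set.Icc (-1 : ℝ) 1 := by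
    intro t ht
    have := abs_le_of_sq_le_sq' ht hs0.le
    exact ⟨by rw [le_div_iff₀ hs0]; linarith, by rw [div_le_iff₀ hs0]; linarith⟩
  have hyi : ∀ j ∈ Finset.Icc 1 (k + 1), y j / s ∈ Set.Icc (-1 : ℝ) 1 := by
    intro j hj
    refine hmem _ ((sq_hermiteZero_le hj).trans ?_)
    rw [hs2]
    push_cast
    linarith
  have hwmem : ∀ j ∈ Finset.Icc 1 (k + 2), w j / s ∈ Set.Icc (-1 : ℝ) 1 := by
    intro j hj
    exact hmem _ ((sq_hermiteZero_le hj).trans hs2.ge)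
  -- Meant for the extreme zeros of `x`, which may leave [-s, s], where `P` need not approximate
  -- `f`; a crude bound suffices for two terms.
  have hend : ∀ j ∈ Finset.Icc 1 (k + 2), |f (x j / s) - P (w j / s)| ≤ 2 * M + ε := by
    intro j hj
    have h1 := hM (x j / s)
    have h2 := hM (w j / s)
    have h3 := hfP _ (hwmem j hj)
    rw [abs_le] at *
    constructor <;> linarith [h1.1, h1.2, h2.1, h2.2, h3.1, h3.2]
  -- Interlacing traps `x (j + 2)` and `w (j + 2)` in the same gap of `y`.
  have hmid : ∀ j ∈ Finset.range k, |f (x (j + 2) / s) - P (w (j + 2) / s)| ≤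
      ε + L * ((y (j + 1 + 1) - y (j + 1)) / s) := by
    intro j hj
    rw [Finset.mem_range] at hj
    have m1 : j + 1 ∈ Finset.Icc 1 (k + 1) := Finset.mem_Icc.2 ⟨by omega, by omega⟩
    have m2 : j + 2 ∈ Finset.Icc 1 (k + 1) := Finset.mem_Icc.2 ⟨by omega, by omega⟩
    have hx1 := (hx _ m1).2
    have hx2 := (hx _ m2).1
    have hw1 := (hwi _ m1).2
    have hw2 := (hwi _ m2).1
    have hxm : x (j + 2) / s ∈ Set.Icc (-1 : ℝ) 1 := by
      refine ⟨(hyi _ m1).1.trans ?_, le_trans ?_ (hyi _ m2).2⟩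
      · exact div_le_div_of_nonneg_right hx1.le hs0.le
      · exact div_le_div_of_nonneg_right hx2.le hs0.le
    have hwm := hwmem (j + 2) (Finset.mem_Icc.2 ⟨by omega, by omega⟩)
    have h1 := hfP _ hxm
    have h2 := hP _ hxm _ hwm
    have h3 : |x (j + 2) / s - w (j + 2) / s| ≤ (y (j + 1 + 1) - y (j + 1)) / s := by
      rw [← sub_div, abs_div, abs_of_pos hs0]
      refine div_le_div_of_nonneg_right ?_ hs0.le
      rw [abs_le]
      constructor <;> linarith
    calc _ ≤ |f (x (j + 2) / s) - P (x (j + 2) / s)| +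
          |P (x (j + 2) / s) - P (w (j + 2) / s)| := abs_sub_le _ _ _
      _ ≤ _ := add_le_add h1 (h2.trans (mul_le_mul_of_nonneg_left h3 hL))
  -- The scaled gaps telescope to at most 2, so the Lipschitz cost does not grow with `k`.
  have htel : ∑ j ∈ Finset.range k, (ε + L * ((y (j + 1 + 1) - y (j + 1)) / s)) ≤
      k * ε + 2 * L := by
    rw [Finset.sum_add_distrib, Finset.sum_const, Finset.card_range, nsmul_eq_mul,
      ← Finset.mul_sum, ← Finset.sum_div, Finset.sum_range_sub (fun j => y (j + 1)), zero_add]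
    have h1 := (hyi (k + 1) (Finset.mem_Icc.2 ⟨by omega, le_rfl⟩)).2
    have h2 := (hyi 1 (Finset.mem_Icc.2 ⟨le_rfl, by omega⟩)).1
    have h3 : (y (k + 1) - y 1) / s ≤ 2 := by rw [sub_div]; linarith
    nlinarith
  refine (Finset.abs_sum_le_sum_abs _ _).trans ?_
  rw [sum_Icc_eq_sum_range]
  have e1 := hend 1 (Finset.mem_Icc.2 ⟨le_rfl, by omega⟩)
  have e2 := hend (k + 2) (Finset.mem_Icc.2 ⟨by omega, le_rfl⟩)
  have e3 := (Finset.sum_le_sum hmid).trans htel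
  linarith

lemma semicircle_integral_sub_le {f P : ℝ → ℝ} (hf : Continuous f) (hP : Continuous P) {ε : ℝ}
    (h : ∀ t ∈ Set.Icc (-1 : ℝ) 1, |f t - P t| ≤ ε) :
    |2 / Real.pi * (∫ x in (-1 : ℝ)..1, P x * √(1 - x ^ 2)) -
      2 / Real.pi * ∫ x in (-1 : ℝ)..1, f x * √(1 - x ^ 2)| ≤ ε := by
  have hpi := Real.pi_pos
  rw [← mul_sub, ← intervalIntegral.integral_sub, abs_mul, abs_of_pos (by positivity)]
  · have h1 : |∫ x in (-1 : ℝ)..1, (P x * √(1 - x ^ 2) - f x * √(1 - x ^ 2))| ≤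
        ∫ x in (-1 : ℝ)..1, ε * √(1 - x ^ 2) := by
      refine (intervalIntegral.abs_integral_le_integral_abs (by norm_num)).trans ?_
      refine intervalIntegral.integral_mono_on (by norm_num)
        (Continuous.intervalIntegrable (by fun_prop) _ _)
        (Continuous.intervalIntegrable (by fun_prop) _ _) fun t ht => ?_
      rw [← sub_mul, abs_mul, abs_of_nonneg (Real.sqrt_nonneg _), abs_sub_comm]
      exact mul_le_mul_of_nonneg_right (h t ht) (Real.sqrt_nonneg _)
    rw [intervalIntegral.integral_const_mul, integral_sqrt_one_sub_sq] at h1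
    calc _ ≤ 2 / Real.pi * (ε * (Real.pi / 2)) := by gcongr
      _ = ε := by field_simp
  · exact Continuous.intervalIntegrable (by fun_prop) _ _
  · exact Continuous.intervalIntegrable (by fun_prop) _ _

/-- Weierstrass approximation on [-1, 1] reduces to a polynomial averaged over the zeros of H_n,
where the moments decide. -/
lemma tendsto_average_of_interlaces {x : ℕ → ℕ → ℝ}
    (hx : ∀ᶠ n in atTop, Interlaces (n - 1) (x n) (hermiteZero (n - 1))) {f : ℝ → ℝ}
    (hf : Continuous f) {M : ℝ} (hM : ∀ t, |f t| ≤ M) :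
    Tendsto (fun n : ℕ => (1 / (n : ℝ)) * ∑ j ∈ Finset.Icc 1 n, f (x n j / √(2 * (n : ℝ)))) atTop
      (𝓝 (2 / Real.pi * ∫ t in (-1 : ℝ)..1, f t * √(1 - t ^ 2))) := by
  rw [Metric.tendsto_nhds]
  intro δ hδ
  -- Budget: 2ε for exchanging the zeros, ε for the polynomial average, ε for the integrals.
  set ε := δ / 4 with hε
  obtain ⟨P, hP⟩ := exists_polynomial_near_of_continuousOn (-1) 1 f hf.continuousOn ε
    (by positivity)
  have hfP : ∀ t ∈ Set.Icc (-1 : ℝ) 1, |f t - P.eval t| ≤ ε := fun t ht => by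
    rw [abs_sub_comm]
    exact (hP t ht).le
  obtain ⟨L, hL0, hL⟩ := exists_lipschitz_polynomial P
  have hint := semicircle_integral_sub_le hf P.continuous hfP
  have hpoly := (Metric.tendsto_nhds.1 (tendsto_average_polynomial P)) ε (by positivity)
  have hsmall : ∀ᶠ n : ℕ in atTop, (2 * L + 2 * (2 * M + ε)) / (n : ℝ) < ε :=
    (Tendsto.const_div_atTop tendsto_natCast_atTop_atTop _).eventually_lt_const (by positivity)
  filter_upwards [hx, hpoly, hsmall, eventually_ge_atTop 2] with n hx hpoly hsmall hn
  obtain ⟨k, rfl⟩ : ∃ k, n = k + 2 := ⟨n - 2, by omega⟩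
  have hcmp := abs_average_sub_le hx hL0 hM hfP hL
  have hn0 : (0 : ℝ) < ((k + 2 : ℕ) : ℝ) := by positivity
  rw [Finset.sum_sub_distrib] at hcmp
  rw [Real.dist_eq] at hpoly ⊢
  set A := ∑ j ∈ Finset.Icc 1 (k + 2), f (x (k + 2) j / √(2 * ((k + 2 : ℕ) : ℝ)))
  set B := ∑ j ∈ Finset.Icc 1 (k + 2), P.eval (hermiteZero (k + 2) j / √(2 * ((k + 2 : ℕ) : ℝ)))
  have h1 : |1 / ((k + 2 : ℕ) : ℝ) * A - 1 / ((k + 2 : ℕ) : ℝ) * B| ≤ 2 * ε := by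
    rw [← mul_sub, abs_mul, abs_of_pos (by positivity), one_div_mul_eq_div, div_le_iff₀ hn0]
    rw [div_lt_iff₀ hn0] at hsmall
    have hk : (k : ℝ) ≤ ((k + 2 : ℕ) : ℝ) := by push_cast; linarith
    have hεpos : 0 < ε := by positivity
    nlinarith
  rw [abs_le] at h1 hint
  rw [abs_lt] at hpoly ⊢
  constructor <;> linarith [h1.1, h1.2, hint.1, hint.2, hpoly.1, hpoly.2]

end HermiteComb

/-! ### Assembly of the main theorem -/

theorem mainTheorem8 (ν : ℝ) (hν0 : 0 ≤ ν) (hν1 : ν ≤ 1 / 4)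
    (K : ℕ) (hK : 1 ≤ K) (γ : ℕ → ℝ) (hγ0 : γ 0 = 1) (hγK : γ K ≠ 0) :
    ∃ N : ℕ, ∀ ρ : ℕ → ℝ, (∀ n, 0 < ρ n) →
      (∀ n : ℕ, 1 ≤ n → 2 * ρ (n - 1) / ρ n ≤ (n : ℝ) ^ ν) →
      ∃ ξ : ℕ → ℕ → ℝ,
        (∀ n ≥ N, HermiteComb.IsZeroEnum (HermiteComb.q K γ ρ n) n (ξ n)) ∧
        (∀ m : ℕ, N ≤ 2 * m →
          HermiteComb.numPos (HermiteComb.q K γ ρ (2 * m)) = m ∧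
          HermiteComb.numNeg (HermiteComb.q K γ ρ (2 * m)) = m) ∧
        (∀ m : ℕ, N ≤ 2 * m + 1 →
          m ≤ HermiteComb.numPos (HermiteComb.q K γ ρ (2 * m + 1)) ∧
          m ≤ HermiteComb.numNeg (HermiteComb.q K γ ρ (2 * m + 1))) ∧
        ((∀ n, ρ n = 2 ^ n) → ∀ m : ℕ, N ≤ 2 * m + 1 →
          (0 < HermiteComb.chi K γ →
            HermiteComb.numPos (HermiteComb.q K γ ρ (2 * m + 1)) = m + 1 ∧
            HermiteComb.numNeg (HermiteComb.q K γ ρ (2 * m + 1)) = m) ∧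
          (HermiteComb.chi K γ < 0 →
            HermiteComb.numPos (HermiteComb.q K γ ρ (2 * m + 1)) = m ∧
            HermiteComb.numNeg (HermiteComb.q K γ ρ (2 * m + 1)) = m + 1) ∧
          (HermiteComb.chi K γ = 0 →
            HermiteComb.numPos (HermiteComb.q K γ ρ (2 * m + 1)) = m ∧
            HermiteComb.numNeg (HermiteComb.q K γ ρ (2 * m + 1)) = m ∧
            (HermiteComb.q K γ ρ (2 * m + 1)).IsRoot 0)) ∧
        (∀ k : ℤ, Tendsto (fun n : ℕ => 2 * √(n : ℝ) * ξ (2 * n) (k + n + 1).toNat) atTop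
          (𝓝 (Real.pi / 2 + k * Real.pi))) ∧
        (∀ k : ℤ, Tendsto (fun n : ℕ => 2 * √(n : ℝ) * ξ (2 * n + 1) (k + n + 1).toNat) atTop
          (𝓝 (k * Real.pi))) ∧
        (∀ f : ℝ → ℝ, Continuous f → (∃ M : ℝ, ∀ x, |f x| ≤ M) →
          Tendsto (fun n : ℕ =>
              (1 / (n : ℝ)) * ∑ j ∈ Finset.Icc 1 n, f (ξ n j / √(2 * (n : ℝ)))) atTop
            (𝓝 (2 / Real.pi * ∫ x in (-1 : ℝ)..1, f x * √(1 - x ^ 2)))) := by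
  obtain ⟨N₁, hN₁⟩ := HermiteComb.eventually_sum_eval_zero_sign K γ
  obtain ⟨N₂, hN₂⟩ := eventually_atTop.1 ((HermiteComb.tendsto_div_sqrt_sqrt
    (∑ j ∈ Finset.Icc 1 K, |γ j| * 4 ^ j)).eventually_lt_const one_pos)
  -- `N₁` governs the sign at 0, `N₂` makes the relative error less than 1, and 2K ≥ 2 gives the
  -- room for the recurrence bound; none depends on `ρ`.
  refine ⟨N₁ + N₂ + 2 * K, fun ρ hρ hratio => ?_⟩
  have hex : ∀ n, ∃ x, N₁ + N₂ + 2 * K ≤ n → HermiteComb.IsZeroEnum (HermiteComb.q K γ ρ n) n x ∧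
      HermiteComb.Interlaces (n - 1) x (HermiteComb.hermiteZero (n - 1)) := by
    intro n
    by_cases hn : N₁ + N₂ + 2 * K ≤ n
    · obtain ⟨x, hx⟩ := HermiteComb.exists_isZeroEnum_q hν0 hν1 hγ0 hρ hratio
        (show 1 ≤ n by omega) (show 2 * K ≤ n by omega) (hN₂ n (by omega))
      exact ⟨x, fun _ => hx⟩
    · exact ⟨fun _ => 0, fun h => absurd h hn⟩
  choose ξ hξ using hex
  have hev : ∀ᶠ n in atTop, N₁ + N₂ + 2 * K ≤ n := eventually_ge_atTop _
  have hlike := HermiteComb.isHermiteLike_q hν0 hν1 hγ0 hρ hratio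
    (hev.mono fun n hn => (hξ n hn).1) (hev.mono fun n hn => (hξ n hn).2)
  have hodd : ∀ m : ℕ, N₁ + N₂ + 2 * K ≤ 2 * m + 1 → 1 ≤ m ∧
      HermiteComb.IsZeroEnum (HermiteComb.q K γ ρ (2 * m + 1)) (2 * m + 1) (ξ (2 * m + 1)) ∧
      HermiteComb.Interlaces (2 * m) (ξ (2 * m + 1)) (HermiteComb.hermiteZero (2 * m)) :=
    fun m hm => ⟨by omega, hξ _ hm⟩
  refine ⟨ξ, fun n hn => (hξ n hn).1, fun m hm => ?_, fun m hm => ?_, fun hρ2 m hm => ?_,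
    hlike.tendsto_zero_even, hlike.tendsto_zero_odd, fun f hf ⟨M, hM⟩ => ?_⟩
  · exact HermiteComb.numPos_numNeg_even (by omega) (hξ _ hm).1 (hξ _ hm).2
  · obtain ⟨hm1, h1, h2⟩ := hodd m hm
    obtain ⟨hp, hn, hz⟩ := HermiteComb.numPos_numNeg_odd hm1 h1 h2
    rcases lt_trichotomy (ξ (2 * m + 1) (m + 1)) 0 with h | h | h
    · have := hn h; omega
    · have := hz h; omega
    · have := hp h; omega
  · obtain ⟨hm1, h1, h2⟩ := hodd m hm
    obtain ⟨hp, hn, hz⟩ := HermiteComb.numPos_numNeg_odd hm1 h1 h2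
    have hlead := (HermiteComb.natDegree_q hγ0 hρ (show K ≤ 2 * m + 1 by omega)).2
    obtain ⟨sp, sn, sz⟩ := HermiteComb.middle_zero_sign hm1 h1 hlead h2
    obtain ⟨hc1, hc2⟩ := hN₁ m (by omega)
    have heval : (HermiteComb.q K γ ρ (2 * m + 1)).eval 0 = ∑ j ∈ Finset.range (K + 1),
        γ j * (HermiteComb.physHermite (2 * m + 1 - j)).eval 0 := by
      rw [HermiteComb.eval_q]
      refine Finset.sum_congr rfl fun j _ => ?_
      rw [hρ2, mul_div_assoc, div_self (by positivity), mul_one]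
    rw [← heval] at hc1 hc2
    refine ⟨fun hχ => ?_, fun hχ => ?_, fun hχ => ?_⟩
    · have hs := pos_of_mul_pos_right (hc1 hχ.ne') hχ.le
      rcases lt_trichotomy (ξ (2 * m + 1) (m + 1)) 0 with h | h | h
      · exact absurd (sn h) hs.not_gt
      · rw [sz h, mul_zero] at hs
        exact absurd hs (lt_irrefl _)
      · exact hp h
    · have hs := neg_of_mul_pos_right (hc1 hχ.ne) hχ.le
      rcases lt_trichotomy (ξ (2 * m + 1) (m + 1)) 0 with h | h | h
      · exact hn h
      · rw [sz h, mul_zero] at hs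
        exact absurd hs (lt_irrefl _)
      · exact absurd (sp h) hs.not_gt
    · have hs := hc2 hχ
      rw [hs, mul_zero] at sp sn
      have h0 : ξ (2 * m + 1) (m + 1) = 0 :=
        le_antisymm (not_lt.1 fun h => (sp h).false) (not_lt.1 fun h => (sn h).false)
      exact ⟨(hz h0).1, (hz h0).2, hs⟩
  · exact HermiteComb.tendsto_average_of_interlaces (hev.mono fun n hn => (hξ n hn).2) hf hM
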